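/- Let $d\ge 1$ be an integer, let $k$ be a field, and let $\mathcal M$ be a skeletally small, $\operatorname{Hom}$-finite, $k$-linear $(d+2)$-angulated category with split idempotents, in the sense of Geiss, Keller and Oppermann, with autoequivalence $\Sigma^d$. Let $\mathcal W$ be an additive subcategory of $\mathcal M$, that is, a full subcategory closed under finite direct sums, direct summands and isomorphisms, and suppose that $\mathcal W$ is closed under $d$-extensions: for every morphism $\delta:W''\to\Sigma^d W'$ with $W',W''\in\mathcal W$ there is a $(d+2)$-angle $W'\to W^1\to\cdots\to W^d\to W''\xrightarrow{\delta}\Sigma^d W'$ with $W^1,\dots,W^d\in\mathcal W$. If $\mathcal X\subseteq\mathcal M$ is a full additive subcategory, a morphism $f:X\to Y$ of $\mathcal X$ is left almost split in $\mathcal X$ if it is not a split monomorphism and every morphism $X\to Z$ of $\mathcal X$ that is not a split monomorphism factors through $f$; right almost split morphisms are defined dually. A $(d+2)$-angle $X^0\xrightarrow{\xi^0}X^1\to\cdots\to X^d\xrightarrow{\xi^d}X^{d+1}\xrightarrow{\xi^{d+1}}\Sigma^dX^0$ of $\mathcal M$ with all $X^i\in\mathcal X$ is an Auslander–Reiten $(d+2)$-angle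 in $\mathcal X$ if $\xi^0$ is left almost split in $\mathcal X$, $\xi^d$ is right almost split in $\mathcal X$, and $\xi^1,\dots,\xi^{d-1}$ lie in the radical of the category (no condition if $d=1$). A $\mathcal W$-cover of $X\in\mathcal M$ is a morphism $\varphi:W^0\to X$ with $W^0\in\mathcal W$ such that every morphism $W'\to X$ with $W'\in\mathcal W$ factors through $\varphi$, and such that every $g:W^0\to W^0$ with $\varphi g=\varphi$ is an isomorphism. Theorem B. Let $W\in\mathcal W$, and suppose that there are $U^0\in\mathcal W$ and a non-zero morphism $W\to\Sigma^dU^0$. Let $$X^0\to X^1\to\cdots\to X^d\to W\to\Sigma^dX^0$$ be an Auslander–Reiten $(d+2)$-angle in $\mathcal M$. Then for every object $W^0$ of $\mathcal M$ the following are equivalent: (a) $X^0$ has a $\mathcal W$-cover of the form $\varphi:W^0\to X^0$; (b) there is an Auslander–Reiten $(d+2)$-angle in $\mathcal W$ of the form $$W^0\to W^1\to\cdots\to W^d\to W\to\Sigma^dW^0.$$ -/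

import Mathlib

open CategoryTheory CategoryTheory.Limits
open scoped ZeroObject

universe v u

namespace HigherAngulated

section Sequences

variable {M : Type u} [Category.{v} M]

/-- A `Σ^d`-sequence `X^0 ⟶ X^1 ⟶ ⋯ ⟶ X^d ⟶ X^{d+1} ⟶ Σ^d X^0`; the functor `S` plays the
role of `Σ^d`. The map with index `i ≤ d` is `ξ^i`, and `last` is `ξ^{d+1}`. -/
structure SigmaSequence (S : M ⥤ M) (d : ℕ) where
  /-- the objects `X^0, …, X^{d+1}` -/
  obj : Fin (d + 2) → M
  /-- the morphisms `ξ^0, …, ξ^d` -/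
  map : ∀ i : Fin (d + 1), obj i.castSucc ⟶ obj i.succ
  /-- the morphism `ξ^{d+1}` -/
  last : obj (Fin.last (d + 1)) ⟶ S.obj (obj 0)

namespace SigmaSequence

variable {S : M ⥤ M} {d : ℕ}

/-- Morphisms of `Σ^d`-sequences. -/
structure Hom (T T' : SigmaSequence S d) where
  /-- the components `φ^0, …, φ^{d+1}` -/
  hom : ∀ i : Fin (d + 2), T.obj i ⟶ T'.obj i
  comm : ∀ i : Fin (d + 1), T.map i ≫ hom i.succ = hom i.castSucc ≫ T'.map i
  comm_last : T.last ≫ S.map (hom 0) = hom (Fin.last (d + 1)) ≫ T'.last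

/-- The objects `X^1, …, X^{d+1}, Σ^d X^0` of the left rotation. -/
def rotObj (T : SigmaSequence S d) : Fin (d + 2) → M :=
  Fin.lastCases (S.obj (T.obj 0)) (fun i : Fin (d + 1) => T.obj i.succ)

/-- For `i ≤ d`, the `i`-th object of the left rotation is `X^{i+1}`. -/
def rotIso (T : SigmaSequence S d) (i : Fin (d + 1)) : T.rotObj i.castSucc ≅ T.obj i.succ :=
  eqToIso (by simp [rotObj])

/-- The last object of the left rotation is `Σ^d X^0`. -/
def rotLastIso (T : SigmaSequence S d) : T.rotObj (Fin.last (d + 1)) ≅ S.obj (T.obj 0) :=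
  eqToIso (by simp [rotObj])

/-- The morphisms `ξ^1, …, ξ^d, ξ^{d+1}` of the left rotation. -/
def rotMap (T : SigmaSequence S d) :
    ∀ i : Fin (d + 1), T.rotObj i.castSucc ⟶ T.rotObj i.succ :=
  Fin.lastCases ((T.rotIso (Fin.last d)).hom ≫ T.last ≫ T.rotLastIso.inv)
    (fun j : Fin d => (T.rotIso j.castSucc).hom ≫ T.map j.succ ≫ (T.rotIso j.succ).inv)

@[simp]
lemma rotMap_castSucc (T : SigmaSequence S d) (j : Fin d) :
    T.rotMap j.castSucc =
      (T.rotIso j.castSucc).hom ≫ T.map j.succ ≫ (T.rotIso j.succ).inv := by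
  simp [rotMap]

@[simp]
lemma rotMap_last (T : SigmaSequence S d) :
    T.rotMap (Fin.last d) =
      (T.rotIso (Fin.last d)).hom ≫ T.last ≫ T.rotLastIso.inv := by
  simp [rotMap]

/-- The morphism `ξ^0` with target identified with the first object of the left rotation. -/
def toRotObj (T : SigmaSequence S d) : T.obj 0 ⟶ T.rotObj 0 :=
  T.map 0 ≫ (T.rotIso 0).inv

section Preadditive

variable [Preadditive M]

/-- The left rotation
`X^1 ⟶ ⋯ ⟶ X^{d+1} ⟶ Σ^d X^0 ⟶ Σ^d X^1`, whose last morphism is `(-1)^d Σ^d(ξ^0)`. -/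
def rotate (T : SigmaSequence S d) : SigmaSequence S d where
  obj := T.rotObj
  map := T.rotMap
  last := ((-1 : ℤ) ^ d) •
    (T.rotLastIso.hom ≫ S.map T.toRotObj)

/-- `T` is a direct sum of `T₁` and `T₂` in the category of `Σ^d`-sequences. -/
def IsDirectSum (T T₁ T₂ : SigmaSequence S d) : Prop :=
  ∃ (i₁ : Hom T₁ T) (i₂ : Hom T₂ T) (p₁ : Hom T T₁) (p₂ : Hom T T₂), ∀ i : Fin (d + 2),
    i₁.hom i ≫ p₁.hom i = 𝟙 _ ∧ i₂.hom i ≫ p₂.hom i = 𝟙 _ ∧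
    i₁.hom i ≫ p₂.hom i = 0 ∧ i₂.hom i ≫ p₁.hom i = 0 ∧
    p₁.hom i ≫ i₁.hom i + p₂.hom i ≫ i₂.hom i = 𝟙 _

/-- The objects `X, X, 0, …, 0` of the trivial sequence. -/
noncomputable def trivialObj [HasZeroObject M] (d : ℕ) (X : M) : Fin (d + 2) → M :=
  Fin.cases X (Fin.cases X (fun _ : Fin d => (0 : M)))

/-- The trivial sequence `X ⟶ X ⟶ 0 ⟶ ⋯ ⟶ 0 ⟶ Σ^d X` with first morphism the identity. -/
noncomputable def trivial [HasZeroObject M] (S : M ⥤ M) (d : ℕ) (X : M) :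
    SigmaSequence S d where
  obj := trivialObj d X
  map := Fin.cases
    (motive := fun i : Fin (d + 1) => trivialObj d X i.castSucc ⟶ trivialObj d X i.succ)
    (𝟙 X) (fun _ : Fin d => 0)
  last := 0

/-- The mapping cone of a morphism of `Σ^d`-sequences:
`X^1 ⊕ Y^0 ⟶ X^2 ⊕ Y^1 ⟶ ⋯ ⟶ Σ^d X^0 ⊕ Y^{d+1} ⟶ Σ^d (X^1 ⊕ Y^0)`. Each morphism has the
entry `-ξ` from the first to the first summand, the component of `φ` from the first to the
second, `η` from the second to the second, and zero from the second to the first. -/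
noncomputable def cone [HasBinaryBiproducts M] {T T' : SigmaSequence S d} (φ : Hom T T') :
    SigmaSequence S d where
  obj i := T.rotObj i ⊞ T'.obj i
  map i := biprod.desc
    (-(T.rotMap i ≫ biprod.inl) + (T.rotIso i).hom ≫ φ.hom i.succ ≫ biprod.inr)
    (T'.map i ≫ biprod.inr)
  last := biprod.desc
    (T.rotLastIso.hom ≫
      (-(S.map (T.toRotObj ≫ (biprod.inl : T.rotObj 0 ⟶ T.rotObj 0 ⊞ T'.obj 0))) +
        S.map (φ.hom 0 ≫ (biprod.inr : T'.obj 0 ⟶ T.rotObj 0 ⊞ T'.obj 0))))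
    (T'.last ≫ S.map (biprod.inr : T'.obj 0 ⟶ T.rotObj 0 ⊞ T'.obj 0))

end Preadditive

end SigmaSequence

end Sequences

section Angulated

variable {M : Type u} [Category.{v} M] [Preadditive M] [HasZeroObject M] [HasBinaryBiproducts M]

/-- The structure of a `(d+2)`-angulated category on the additive category `M` with the
autoequivalence `S` (which plays the role of `Σ^d`). -/
structure Angulation (S : M ⥤ M) [S.IsEquivalence] (d : ℕ) where
  /-- the collection of `(d+2)`-angles -/
  angles : Set (SigmaSequence S d)
  /-- (N1) closure under sums and summands -/
  mem_iff_of_isDirectSum : ∀ T T₁ T₂ : SigmaSequence S d, T.IsDirectSum T₁ T₂ →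
    (T ∈ angles ↔ T₁ ∈ angles ∧ T₂ ∈ angles)
  /-- (N1) trivial sequences are `(d+2)`-angles -/
  trivial_mem : ∀ X : M, SigmaSequence.trivial S d X ∈ angles
  /-- (N1) every morphism is the first morphism of a `(d+2)`-angle -/
  exists_angle : ∀ {X Y : M} (f : X ⟶ Y), ∃ T ∈ angles,
    ∃ (e₀ : T.obj 0 ≅ X) (e₁ : T.obj (0 : Fin (d + 1)).succ ≅ Y),
      T.map 0 ≫ e₁.hom = e₀.hom ≫ f
  /-- (N2) rotation -/
  rotate_mem_iff : ∀ T : SigmaSequence S d, T ∈ angles ↔ T.rotate ∈ angles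
  /-- (N3) completion of a commutative square to a morphism of sequences -/
  exists_hom : ∀ T ∈ angles, ∀ T' ∈ angles, ∀ (φ₀ : T.obj 0 ⟶ T'.obj 0)
    (φ₁ : T.obj (0 : Fin (d + 1)).succ ⟶ T'.obj (0 : Fin (d + 1)).succ),
    T.map 0 ≫ φ₁ = φ₀ ≫ T'.map 0 →
      ∃ φ : SigmaSequence.Hom T T', φ.hom 0 = φ₀ ∧ φ.hom (0 : Fin (d + 1)).succ = φ₁
  /-- (N4) the completion can be chosen such that its mapping cone is a `(d+2)`-angle -/
  exists_hom_cone_mem : ∀ T ∈ angles, ∀ T' ∈ angles, ∀ (φ₀ : T.obj 0 ⟶ T'.obj 0)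
    (φ₁ : T.obj (0 : Fin (d + 1)).succ ⟶ T'.obj (0 : Fin (d + 1)).succ),
    T.map 0 ≫ φ₁ = φ₀ ≫ T'.map 0 →
      ∃ φ : SigmaSequence.Hom T T', φ.hom 0 = φ₀ ∧ φ.hom (0 : Fin (d + 1)).succ = φ₁ ∧
        SigmaSequence.cone φ ∈ angles

/-- An additive subcategory: a full subcategory (given by its class of objects) closed under
finite direct sums, direct summands and isomorphisms. -/
structure IsAdditiveSubcategory (P : ObjectProperty M) : Prop where
  of_iso : ∀ {X Y : M}, (X ≅ Y) → P X → P Y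
  zero : P (0 : M)
  sum : ∀ {X Y : M}, P X → P Y → P (X ⊞ Y)
  summand : ∀ {X Y : M}, P (X ⊞ Y) → P X ∧ P Y

/-- Closure under `d`-extensions: every `δ : W'' ⟶ Σ^d W'` with `W', W''` in the subcategory is
the last morphism of a `(d+2)`-angle `W' ⟶ W^1 ⟶ ⋯ ⟶ W^d ⟶ W'' ⟶ Σ^d W'` with
`W^1, …, W^d` in the subcategory. -/
def ClosedUnderExtensions {S : M ⥤ M} [S.IsEquivalence] {d : ℕ} (A : Angulation S d)
    (P : ObjectProperty M) : Prop :=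
  ∀ (W' W'' : M), P W' → P W'' → ∀ δ : W'' ⟶ S.obj W',
    ∃ T ∈ A.angles, ∃ (e₀ : T.obj 0 ≅ W') (e₁ : T.obj (Fin.last (d + 1)) ≅ W''),
      T.last ≫ S.map e₀.hom = e₁.hom ≫ δ ∧
      ∀ i : Fin (d + 2), i ≠ 0 → i ≠ Fin.last (d + 1) → P (T.obj i)

end Angulated

section AlmostSplit

variable {M : Type u} [Category.{v} M]

/-- `f : X ⟶ Y` is left almost split in the full subcategory `P` (which contains `X` and `Y`). -/
def IsLeftAlmostSplit (P : ObjectProperty M) {X Y : M} (f : X ⟶ Y) : Prop :=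
  ¬ IsSplitMono f ∧ ∀ Z : M, P Z → ∀ g : X ⟶ Z, ¬ IsSplitMono g → ∃ h : Y ⟶ Z, f ≫ h = g

/-- `f : X ⟶ Y` is right almost split in the full subcategory `P` (which contains `X` and `Y`). -/
def IsRightAlmostSplit (P : ObjectProperty M) {X Y : M} (f : X ⟶ Y) : Prop :=
  ¬ IsSplitEpi f ∧ ∀ Z : M, P Z → ∀ g : Z ⟶ Y, ¬ IsSplitEpi g → ∃ h : Z ⟶ X, h ≫ f = g

/-- Membership in the radical of the category. (For a full subcategory that contains `X` and `Y`
the condition is the same.) -/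
def IsRadical [Preadditive M] {X Y : M} (f : X ⟶ Y) : Prop :=
  ∀ g : Y ⟶ X, IsIso (𝟙 X - f ≫ g)

/-- Right minimal morphisms. -/
def IsRightMinimal {X Y : M} (f : X ⟶ Y) : Prop :=
  ∀ g : X ⟶ X, g ≫ f = f → IsIso g

/-- `f : W ⟶ X` is a precover of `X` with respect to the full subcategory `P`. -/
def IsPrecover (P : ObjectProperty M) {W X : M} (f : W ⟶ X) : Prop :=
  P W ∧ ∀ W' : M, P W' → ∀ g : W' ⟶ X, ∃ h : W' ⟶ W, h ≫ f = g

/-- `f : W ⟶ X` is a cover of `X` with respect to the full subcategory `P`. -/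
def IsCover (P : ObjectProperty M) {W X : M} (f : W ⟶ X) : Prop :=
  IsPrecover P f ∧ IsRightMinimal f

variable [Preadditive M] [HasZeroObject M] [HasBinaryBiproducts M]

/-- `T` is an Auslander-Reiten `(d+2)`-angle in the full subcategory `P`. -/
structure IsARAngleIn {S : M ⥤ M} [S.IsEquivalence] {d : ℕ} (A : Angulation S d)
    (P : ObjectProperty M) (T : SigmaSequence S d) : Prop where
  mem_angles : T ∈ A.angles
  obj_mem : ∀ i, P (T.obj i)
  left : IsLeftAlmostSplit P (T.map 0)
  right : IsRightAlmostSplit P (T.map (Fin.last d))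
  /-- `ξ^1, …, ξ^{d-1}` are radical -/
  radical : ∀ i : Fin (d + 1), i ≠ 0 → i ≠ Fin.last d → IsRadical (T.map i)

/-- `T` is an Auslander-Reiten `(d+2)`-angle in the whole category. -/
def IsARAngle {S : M ⥤ M} [S.IsEquivalence] {d : ℕ} (A : Angulation S d)
    (T : SigmaSequence S d) : Prop :=
  IsARAngleIn A ⊤ T

end AlmostSplit

end HigherAngulated

namespace HigherAngulated

/-! The theorem rests on a duality pairing. Let δ : W → Σ^d X^0 be the last morphism of the given
angle. As ξ^d is right almost split, δ is a socle element (`IsSocle`). Closure under d-extensions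
makes every non-zero h : W → Σ^d W' with W' in 𝒲 divide every socle element
(`exists_comp_map_eq_of_isSocle`). As ξ^0 is left almost split in the whole category, δ factors
through Σ^d f for every non-zero f with target X^0 (`exists_comp_map_eq_last`).

The hinge is `isPrecover_of_isSocle`. Suppose φ : W₀ → X^0 carries a socle element δ' : W → Σ^d W₀
to δ. Fix a linear form that is non-zero on δ and consider Hom(W', W₀) → Hom(W', X^0) → Hom(W, Σ^d
W')^*. The second map is injective by the factorisation of δ, and the composite is surjective by the
divisibility of δ', so the first map is surjective: φ is a precover.

From (b) to (a), the last morphism of the angle in 𝒲 is a socle element and divides δ; the quotient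
is φ, and the local endomorphism ring of W₀ makes it right minimal. From (a) to (b), the non-zero
morphism W → Σ^d U^0 yields a lift of δ along the cover, and `exists_lift_minimal` picks a lift δ'
of least rank. The local endomorphism ring of W makes δ' a socle element (`isSocle_of_minimal`). Any
endomorphism fixing δ' composes with φ to another precover, so minimality of φ makes it invertible;
hence morphisms not annihilating δ' are split monomorphisms. An angle on δ' with radical middle maps
(`exists_radical_angle`) is then Auslander–Reiten. -/

lemma sign_smul_sign_smul {G : Type*} [AddCommGroup G] (d : ℕ) (x : G) :
    ((-1 : ℤ) ^ d) • ((-1 : ℤ) ^ d) • x = x := by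
  rw [smul_smul, ← mul_pow]
  simp

lemma sign_smul_injective {G : Type*} [AddCommGroup G] (d : ℕ) {x y : G}
    (h : ((-1 : ℤ) ^ d) • x = ((-1 : ℤ) ^ d) • y) : x = y := by
  rw [← sign_smul_sign_smul d x, h, sign_smul_sign_smul]

/-! ### Transport of squares along the identifications of objects in a rotation -/

section Conjugation

variable {M : Type u} [Category.{v} M]

lemma comm_of_conj {A A₁ B B₁ A' A₁' B' B₁' : M} (a : A ≅ A₁) (b : B ≅ B₁) (a' : A' ≅ A₁')
    (b' : B' ≅ B₁') (f : A₁ ⟶ B₁) (f' : A₁' ⟶ B₁') (φ : A ⟶ A') (ψ : B ⟶ B')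
    (h : (a.hom ≫ f ≫ b.inv) ≫ ψ = φ ≫ a'.hom ≫ f' ≫ b'.inv) :
    f ≫ b.inv ≫ ψ ≫ b'.hom = (a.inv ≫ φ ≫ a'.hom) ≫ f' := by
  rw [Category.assoc, Category.assoc, ← Iso.eq_inv_comp] at h
  simpa using congrArg (fun t => t ≫ b'.hom) h

lemma conj_comm {A A₁ B B₁ A' A₁' B' B₁' : M} (a : A ≅ A₁) (b : B ≅ B₁) (a' : A' ≅ A₁')
    (b' : B' ≅ B₁') (f : A₁ ⟶ B₁) (f' : A₁' ⟶ B₁') (φ : A₁ ⟶ A₁') (ψ : B₁ ⟶ B₁')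
    (h : f ≫ ψ = φ ≫ f') :
    (a.hom ≫ f ≫ b.inv) ≫ (b.hom ≫ ψ ≫ b'.inv) =
      (a.hom ≫ φ ≫ a'.inv) ≫ a'.hom ≫ f' ≫ b'.inv := by
  simp [reassoc_of% h]

lemma eq_of_conj {A A₁ B B₁ : M} (a : A ≅ A₁) (b : B ≅ B₁) (φ : A ⟶ B) (φ₁ ψ : A₁ ⟶ B₁)
    (hψ : ψ = a.inv ≫ φ ≫ b.hom) (h : φ = a.hom ≫ φ₁ ≫ b.inv) : ψ = φ₁ := by
  simp [hψ, h]

lemma comp_eq_zero_of_conj [HasZeroMorphisms M] {A A₁ B B₁ C C₁ : M} (a : A ≅ A₁) (b : B ≅ B₁)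
    (c : C ≅ C₁) (f : A₁ ⟶ B₁) (g : B₁ ⟶ C₁)
    (h : (a.hom ≫ f ≫ b.inv) ≫ b.hom ≫ g ≫ c.inv = 0) : f ≫ g = 0 := by
  simpa using congrArg (fun t => a.inv ≫ t ≫ c.hom) h

lemma comm_of_map_conj (S : M ⥤ M) [S.Faithful] {X Y Y₁ X' Y' Y₁' : M} (b : Y₁ ≅ Y)
    (b' : Y₁' ≅ Y') (f : X ⟶ Y) (f' : X' ⟶ Y') (φ : X ⟶ X') (ψ : Y₁ ⟶ Y₁')
    (h : S.map f ≫ (S.mapIso b).inv ≫ S.map ψ ≫ (S.mapIso b').hom = S.map φ ≫ S.map f') :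
    f ≫ b.inv ≫ ψ ≫ b'.hom = φ ≫ f' :=
  S.map_injective (by simpa using h)

lemma isIso_sign_smul_conj [Preadditive M] (S : M ⥤ M) (d : ℕ) {A B X Y : M} (a : A ≅ S.obj X)
    (b : B ≅ S.obj Y) (f : X ⟶ Y) [IsIso f] :
    IsIso (((-1 : ℤ) ^ d) • (a.hom ≫ S.map f ≫ b.inv)) := by
  obtain h | h := neg_one_pow_eq_or ℤ d <;> rw [h]
  · rw [one_smul]
    infer_instance
  · rw [neg_smul, one_smul]
    exact (-asIso (a.hom ≫ S.map f ≫ b.inv)).isIso_hom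

/-- Strips the identifications and the sign (-1)^d from exactness of a rotated angle, leaving a
statement about f itself; used for `exists_weakCokernel`. -/
lemma factor_of_conj [Preadditive M] (S : M ⥤ M) [S.Additive] {A A₁ B B₁ C C₁ X Y : M}
    (a : A₁ ≅ S.obj A) (e₀ : A ≅ X) (b : B₁ ≅ B) (e₁ : B ≅ Y) (c : C₁ ≅ C) (f₁ : A ⟶ B)
    (f : X ⟶ Y) (he : f₁ ≫ e₁.hom = e₀.hom ≫ f) (g₁ : B ⟶ C) (hz : f₁ ≫ g₁ = 0) (d : ℕ)
    (r : B₁ ⟶ C₁) (hr : r = b.hom ≫ g₁ ≫ c.inv)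
    (H : ∀ (V : M) (h : V ⟶ S.obj B₁), h ≫ S.map r = 0 →
      ∃ g : V ⟶ A₁, g ≫ (((-1 : ℤ) ^ d) • (a.hom ≫ S.map f₁ ≫ (S.mapIso b).inv)) = h) :
    ∃ (C : M) (c : Y ⟶ C), f ≫ c = 0 ∧ ∀ (V : M) (h : V ⟶ S.obj Y), h ≫ S.map c = 0 →
      ∃ g : V ⟶ S.obj X, g ≫ S.map f = h := by
  have hf : f = e₀.inv ≫ f₁ ≫ e₁.hom := by simp [he]
  refine ⟨C, e₁.inv ≫ g₁, by simp [hf, hz], fun V h hh => ?_⟩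
  obtain ⟨g, hg⟩ := H V (h ≫ S.map (e₁.inv ≫ b.inv)) (by
    simp only [S.map_comp] at hh
    simp [hr, reassoc_of% hh])
  refine ⟨((-1 : ℤ) ^ d) • (g ≫ a.hom ≫ S.map e₀.hom), ?_⟩
  have h' := congrArg (fun t => t ≫ S.map (b.hom ≫ e₁.hom)) hg
  simpa [hf, ← S.map_comp, -Functor.map_comp, -Int.reduceNeg] using h'

end Conjugation

/-! ### Rotation and the long exact sequences of an angle -/

section Angles

variable {M : Type u} [Category.{v} M] [Preadditive M]
variable {S : M ⥤ M} {d : ℕ}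

namespace SigmaSequence

/-- The morphism `ξ^0`. -/
def first (T : SigmaSequence S d) : T.obj 0 ⟶ T.obj (0 : Fin (d + 1)).succ := T.map 0

/-- The morphism `ξ^d`. -/
def final (T : SigmaSequence S d) :
    T.obj (Fin.last d).castSucc ⟶ T.obj (Fin.last (d + 1)) := T.map (Fin.last d)

/-- For `i ≤ d`, the `i`-th object of the left rotation is `X^{i+1}`. -/
def rotateIso (T : SigmaSequence S d) (i : Fin (d + 1)) :
    T.rotate.obj i.castSucc ≅ T.obj i.succ := T.rotIso i

/-- The object of the left rotation with index `0` is `X^1`. -/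
def rotateZeroIso (T : SigmaSequence S d) :
    T.rotate.obj 0 ≅ T.obj (0 : Fin (d + 1)).succ := T.rotIso 0

/-- The object of the left rotation with index `d` is `X^{d+1}`. -/
def rotateFinalIso (T : SigmaSequence S d) :
    T.rotate.obj (Fin.last d).castSucc ≅ T.obj (Fin.last (d + 1)) := T.rotIso (Fin.last d)

/-- The last object of the left rotation is `Σ^d X^0`. -/
def rotateLastIso (T : SigmaSequence S d) :
    T.rotate.obj (Fin.last (d + 1)) ≅ S.obj (T.obj 0) := T.rotLastIso

lemma rotate_map_castSucc (T : SigmaSequence S d) (j : Fin d) :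
    T.rotate.map j.castSucc =
      (T.rotIso j.castSucc).hom ≫ T.map j.succ ≫ (T.rotIso j.succ).inv :=
  T.rotMap_castSucc j

lemma rotate_final (T : SigmaSequence S d) :
    T.rotate.final = T.rotateFinalIso.hom ≫ T.last ≫ T.rotateLastIso.inv :=
  T.rotMap_last

lemma rotate_last (T : SigmaSequence S d) :
    T.rotate.last = ((-1 : ℤ) ^ d) •
      (T.rotateLastIso.hom ≫ S.map T.first ≫ (S.mapIso T.rotateZeroIso).inv) := by
  have h : S.map T.toRotObj = S.map T.first ≫ (S.mapIso T.rotateZeroIso).inv :=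
    S.map_comp _ _
  rw [← h]
  rfl

/-- A morphism between left rotations comes from a morphism of the original sequences. -/
lemma exists_hom_of_rotate [S.Full] [S.Faithful] (T T' : SigmaSequence S d)
    (φ : Hom T.rotate T'.rotate) :
    ∃ ψ : Hom T T',
      (∀ i : Fin (d + 1), ψ.hom i.succ =
        (T.rotateIso i).inv ≫ φ.hom i.castSucc ≫ (T'.rotateIso i).hom) ∧
      S.map (ψ.hom 0) =
        T.rotateLastIso.inv ≫ φ.hom (Fin.last (d + 1)) ≫ T'.rotateLastIso.hom := by
  obtain ⟨ψ₀, hψ₀⟩ := S.map_surjective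
    (T.rotateLastIso.inv ≫ φ.hom (Fin.last (d + 1)) ≫ T'.rotateLastIso.hom)
  have h0 : T.first ≫ T.rotateZeroIso.inv ≫ φ.hom 0 ≫ T'.rotateZeroIso.hom =
      ψ₀ ≫ T'.first := by
    have h := φ.comm_last
    rw [rotate_last, rotate_last, Preadditive.zsmul_comp, Preadditive.comp_zsmul] at h
    have h := comm_of_conj _ _ _ _ _ _ _ _ (sign_smul_injective d h)
    rw [← hψ₀] at h
    exact comm_of_map_conj S _ _ _ _ _ _ h
  refine ⟨⟨Fin.cases ψ₀
    (fun i => (T.rotateIso i).inv ≫ φ.hom i.castSucc ≫ (T'.rotateIso i).hom), ?_, ?_⟩, ?_, ?_⟩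
  · intro i
    induction i using Fin.cases with
    | zero => exact h0
    | succ j =>
      have h := φ.comm j.castSucc
      rw [rotate_map_castSucc, rotate_map_castSucc] at h
      exact comm_of_conj (T.rotIso j.castSucc) (T.rotIso j.succ) (T'.rotIso j.castSucc)
        (T'.rotIso j.succ) _ _ _ _ h
  · have h : T.rotate.final ≫ φ.hom (Fin.last (d + 1)) =
      φ.hom (Fin.last d).castSucc ≫ T'.rotate.final := φ.comm (Fin.last d)
    rw [rotate_final, rotate_final] at h
    have h := comm_of_conj _ _ _ _ _ _ _ _ h
    rw [← hψ₀] at h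
    exact h
  · intro i
    rfl
  · exact hψ₀

/-- The last morphism of the left rotation of a trivial sequence is an isomorphism. -/
lemma isIso_rotate_trivial_last [HasZeroObject M] (V : M) : IsIso (SigmaSequence.trivial S d V).rotate.last := by
  have h : IsIso (SigmaSequence.trivial S d V).first := inferInstanceAs (IsIso (𝟙 V))
  rw [rotate_last]
  exact isIso_sign_smul_conj S d _ (S.mapIso (SigmaSequence.trivial S d V).rotateZeroIso) _

end SigmaSequence

variable [HasZeroObject M] [HasBinaryBiproducts M] [S.IsEquivalence]

/-- Additivity of Σ^d need not be assumed: an equivalence preserves products. -/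
lemma additive_of_isEquivalence (S : M ⥤ M) [S.IsEquivalence] : S.Additive :=
  S.additive_of_preserves_binary_products

namespace Angulation

open SigmaSequence

variable (A : Angulation S d)

/-- A commutative square at any of the maps `ξ^0, …, ξ^d` extends to a morphism of angles. -/
lemma exists_hom_of_comm (i : Fin (d + 1)) : ∀ T ∈ A.angles, ∀ T' ∈ A.angles,
    ∀ (φ₀ : T.obj i.castSucc ⟶ T'.obj i.castSucc) (φ₁ : T.obj i.succ ⟶ T'.obj i.succ),
    T.map i ≫ φ₁ = φ₀ ≫ T'.map i →
      ∃ φ : Hom T T', φ.hom i.castSucc = φ₀ ∧ φ.hom i.succ = φ₁ := by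
  induction i using Fin.induction with
  | zero => exact A.exists_hom
  | succ j ih =>
    intro T hT T' hT' φ₀ φ₁ h
    -- The map ξ^{j+1} is the map with index j of the left rotation.
    obtain ⟨φ, h₀, h₁⟩ := ih T.rotate ((A.rotate_mem_iff T).1 hT)
      T'.rotate ((A.rotate_mem_iff T').1 hT')
      ((T.rotIso j.castSucc).hom ≫ φ₀ ≫ (T'.rotIso j.castSucc).inv)
      ((T.rotIso j.succ).hom ≫ φ₁ ≫ (T'.rotIso j.succ).inv) (by
        rw [rotate_map_castSucc, rotate_map_castSucc]
        exact conj_comm (T.rotIso j.castSucc) (T.rotIso j.succ) (T'.rotIso j.castSucc)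
          (T'.rotIso j.succ) _ _ _ _ h)
    obtain ⟨ψ, hψ, -⟩ := exists_hom_of_rotate T T' φ
    exact ⟨ψ, eq_of_conj _ _ _ _ _ (hψ j.castSucc) h₀, eq_of_conj _ _ _ _ _ (hψ j.succ) h₁⟩

/-- A commutative square at `ξ^{d+1}` extends to a morphism of angles. -/
lemma exists_hom_of_comm_last {T T' : SigmaSequence S d} (hT : T ∈ A.angles)
    (hT' : T' ∈ A.angles) (φ₀ : T.obj 0 ⟶ T'.obj 0)
    (φ₁ : T.obj (Fin.last (d + 1)) ⟶ T'.obj (Fin.last (d + 1)))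
    (h : T.last ≫ S.map φ₀ = φ₁ ≫ T'.last) :
    ∃ φ : Hom T T', φ.hom 0 = φ₀ ∧ φ.hom (Fin.last (d + 1)) = φ₁ := by
  obtain ⟨φ, h₀, h₁⟩ := A.exists_hom_of_comm (Fin.last d) T.rotate
    ((A.rotate_mem_iff T).1 hT) T'.rotate ((A.rotate_mem_iff T').1 hT')
    (T.rotateFinalIso.hom ≫ φ₁ ≫ T'.rotateFinalIso.inv)
    (T.rotateLastIso.hom ≫ S.map φ₀ ≫ T'.rotateLastIso.inv) (by
      have h' := conj_comm T.rotateFinalIso T.rotateLastIso T'.rotateFinalIso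
        T'.rotateLastIso _ _ _ _ h
      rw [← rotate_final, ← rotate_final] at h'
      exact h')
  obtain ⟨ψ, hψ, hψ₀⟩ := exists_hom_of_rotate T T' φ
  exact ⟨ψ, S.map_injective (eq_of_conj _ _ _ _ _ hψ₀ h₁),
    eq_of_conj _ _ _ _ _ (hψ (Fin.last d)) h₀⟩

/-- Consecutive maps of an angle compose to zero. -/
lemma map_comp_map (j : Fin d) : ∀ T ∈ A.angles, T.map j.castSucc ≫ T.map j.succ = 0 := by
  obtain _ | e := d
  · exact j.elim0
  induction j using Fin.induction with
  | zero =>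
    intro T hT
    -- In the trivial sequence on X^0 the second map is zero, which forces ξ^0 followed by ξ^1 to
    -- vanish.
    obtain ⟨φ, h₀, h₁⟩ := A.exists_hom _ (A.trivial_mem (T.obj 0)) T hT (𝟙 _) (T.map 0) rfl
    have h := φ.comm (Fin.succ 0)
    have h₁' : φ.hom (Fin.succ (0 : Fin (e + 1))).castSucc = T.map 0 := h₁
    rw [h₁'] at h
    exact h.symm.trans zero_comp
  | succ i ih =>
    intro T hT
    have h := ih T.rotate ((A.rotate_mem_iff T).1 hT)
    have e₂ : T.rotate.map i.castSucc.succ =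
      (T.rotIso i.succ.castSucc).hom ≫ T.map i.succ.succ ≫ (T.rotIso i.succ.succ).inv :=
      T.rotate_map_castSucc i.succ
    rw [e₂, rotate_map_castSucc] at h
    exact comp_eq_zero_of_conj (T.rotIso i.castSucc.castSucc) (T.rotIso i.castSucc.succ)
      (T.rotIso i.succ.succ) _ _ h

/-- The maps `ξ^d` and `ξ^{d+1}` of an angle compose to zero. -/
lemma final_comp_last (hd : 1 ≤ d) {T : SigmaSequence S d} (hT : T ∈ A.angles) :
    T.final ≫ T.last = 0 := by
  obtain ⟨e, rfl⟩ : ∃ e, d = e + 1 := ⟨d - 1, by omega⟩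
  have h : T.rotate.map (Fin.last e).castSucc ≫ T.rotate.final = 0 :=
    A.map_comp_map (Fin.last e) T.rotate ((A.rotate_mem_iff T).1 hT)
  rw [rotate_final, rotate_map_castSucc] at h
  exact comp_eq_zero_of_conj (T.rotIso (Fin.last e).castSucc) T.rotateFinalIso
    T.rotateLastIso _ _ h

/-- The maps `ξ^{d+1}` and `Σ^d ξ^0` of an angle compose to zero. -/
lemma last_comp_first (hd : 1 ≤ d) {T : SigmaSequence S d} (hT : T ∈ A.angles) :
    T.last ≫ S.map T.first = 0 := by
  have h := A.final_comp_last hd ((A.rotate_mem_iff T).1 hT)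
  rw [rotate_final, rotate_last, Preadditive.comp_zsmul] at h
  exact comp_eq_zero_of_conj _ _ _ _ _ (sign_smul_injective d (h.trans (smul_zero _).symm))

/-- Exactness of `Hom(-, V)` at `X^0`. -/
lemma exists_first_comp_eq {T : SigmaSequence S d} (hT : T ∈ A.angles) {V : M}
    (f : T.obj 0 ⟶ V) (h : T.last ≫ S.map f = 0) :
    ∃ g : T.obj (0 : Fin (d + 1)).succ ⟶ V, T.first ≫ g = f := by
  -- The first map of the trivial sequence is the identity of V, so the component at X^1 extends f.
  obtain ⟨φ, h₀, -⟩ := A.exists_hom_of_comm_last hT (A.trivial_mem V) f 0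
    (h.trans zero_comp.symm)
  have h : T.first ≫ φ.hom (Fin.succ 0) = φ.hom 0 ≫ 𝟙 V := φ.comm 0
  rw [h₀] at h
  exact ⟨φ.hom (Fin.succ 0), h.trans (Category.comp_id f)⟩

/-- Exactness of `Hom(-, Σ^d V)` at `X^{d+1}`. -/
lemma exists_last_comp_eq {T : SigmaSequence S d} (hT : T ∈ A.angles) {V : M}
    (f : T.obj (Fin.last (d + 1)) ⟶ S.obj V) (h : T.final ≫ f = 0) :
    ∃ g : T.obj 0 ⟶ V, T.last ≫ S.map g = f := by
  let R := SigmaSequence.trivial S d V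
  have hR : IsIso R.rotate.last := isIso_rotate_trivial_last V
  let ι : R.rotate.obj 0 ≅ V := R.rotateZeroIso
  obtain ⟨φ, -, h₁⟩ := A.exists_hom_of_comm (Fin.last d) T hT R.rotate
    ((A.rotate_mem_iff R).1 (A.trivial_mem V)) 0
    (f ≫ (S.mapIso ι).inv ≫ inv R.rotate.last) (by
      have h' : T.final ≫ f ≫ (S.mapIso ι).inv ≫ inv R.rotate.last = 0 := by
        rw [reassoc_of% h, zero_comp]
      exact h'.trans zero_comp.symm)
  have h := φ.comm_last
  have h₁' : φ.hom (Fin.last (d + 1)) = f ≫ (S.mapIso ι).inv ≫ inv R.rotate.last := h₁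
  rw [h₁'] at h
  refine ⟨φ.hom 0 ≫ ι.hom, ?_⟩
  rw [S.map_comp, reassoc_of% h]
  simp

/-- Exactness of `Hom(V, -)` at `X^{d+1}`. -/
lemma exists_comp_final_eq {T : SigmaSequence S d} (hT : T ∈ A.angles) {V : M}
    (f : V ⟶ T.obj (Fin.last (d + 1))) (h : f ≫ T.last = 0) :
    ∃ g : V ⟶ T.obj (Fin.last d).castSucc, g ≫ T.final = f := by
  have := additive_of_isEquivalence S
  -- Rotating twice moves the identity of the trivial sequence to the place of ξ^d, where its
  -- inverse lifts f.
  let R := SigmaSequence.trivial S d (S.objPreimage V)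
  let Q := R.rotate.rotate
  have hQ : Q ∈ A.angles :=
    (A.rotate_mem_iff _).1 ((A.rotate_mem_iff R).1 (A.trivial_mem _))
  have hQf : IsIso Q.final := by
    have hR : IsIso R.rotate.last := isIso_rotate_trivial_last _
    rw [rotate_final]
    infer_instance
  let ι : R.rotate.obj 0 ≅ S.objPreimage V := R.rotateZeroIso
  let κ : Q.obj (Fin.last (d + 1)) ≅ V := R.rotate.rotateLastIso ≪≫ S.mapIso ι ≪≫
    S.objObjPreimageIso V
  obtain ⟨φ, -, h₁⟩ := A.exists_hom_of_comm_last hQ hT 0 (κ.hom ≫ f) (by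
    rw [Category.assoc, h, S.map_zero, comp_zero, comp_zero])
  have h : Q.final ≫ φ.hom (Fin.last (d + 1)) = φ.hom (Fin.last d).castSucc ≫ T.final :=
    φ.comm (Fin.last d)
  rw [h₁] at h
  refine ⟨κ.inv ≫ inv Q.final ≫ φ.hom (Fin.last d).castSucc, ?_⟩
  simp [← h]

/-- Exactness of `Hom(V, -)` at `Σ^d X^0`. -/
lemma exists_comp_last_eq {T : SigmaSequence S d} (hT : T ∈ A.angles) {V : M}
    (f : V ⟶ S.obj (T.obj 0)) (h : f ≫ S.map T.first = 0) :
    ∃ g : V ⟶ T.obj (Fin.last (d + 1)), g ≫ T.last = f := by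
  obtain ⟨g, hg⟩ := A.exists_comp_final_eq ((A.rotate_mem_iff T).1 hT)
    (f ≫ T.rotateLastIso.inv) (by
      rw [rotate_last, Preadditive.comp_zsmul, Category.assoc, Iso.inv_hom_id_assoc,
        reassoc_of% h, zero_comp, smul_zero])
  rw [rotate_final] at hg
  refine ⟨g ≫ T.rotateFinalIso.hom, ?_⟩
  simpa using congrArg (fun t => t ≫ T.rotateLastIso.hom) hg

/-- Every morphism `f` admits a morphism `c` with `f ≫ c = 0` such that each morphism to the
suspended target of `f` that is annihilated by `Σ^d c` factors through `Σ^d f`. -/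
lemma exists_weakCokernel (hd : 1 ≤ d) (A : Angulation S d) {X Y : M} (f : X ⟶ Y) :
    ∃ (C : M) (c : Y ⟶ C), f ≫ c = 0 ∧ ∀ (V : M) (h : V ⟶ S.obj Y), h ≫ S.map c = 0 →
      ∃ g : V ⟶ S.obj X, g ≫ S.map f = h := by
  obtain ⟨e, rfl⟩ : ∃ e, d = e + 1 := ⟨d - 1, by omega⟩
  have := additive_of_isEquivalence S
  obtain ⟨T, hT, e₀, e₁, he⟩ := A.exists_angle f
  have he : T.first ≫ e₁.hom = e₀.hom ≫ f := he
  have hR : T.rotate ∈ A.angles := (A.rotate_mem_iff T).1 hT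
  -- The morphism c is ξ^1 of an angle starting with f; the factorisation is exactness of the
  -- rotated angle at the suspension of its first object.
  refine factor_of_conj S T.rotateLastIso e₀ T.rotateZeroIso e₁ (T.rotateIso (Fin.succ 0))
    T.first f he (T.map (Fin.succ 0)) (A.map_comp_map 0 T hT) (e + 1) T.rotate.first
    (T.rotate_map_castSucc 0) fun V h hh => ?_
  rw [← rotate_last]
  exact A.exists_comp_last_eq hR h hh

end Angulation

end Angles

/-! ### Idempotents and pairings in finite dimension -/

section LinearAlgebra

/-- In a commutative Artinian ring, the complement of a non-unit divides a non-zero idempotent. -/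
lemma exists_idempotent_of_commRing {C : Type*} [CommRing C] [IsArtinianRing C] {u : C}
    (hu : ¬ IsUnit u) : ∃ t : C, (1 - u) * t ≠ 0 ∧ ((1 - u) * t) * ((1 - u) * t) = (1 - u) * t := by
  -- Fitting decomposition: the powers of u stabilise, and f = u^N y^N is the idempotent of the part
  -- on which u is invertible. The required idempotent is 1 - f.
  obtain ⟨n, y, hy⟩ := IsArtinian.exists_pow_succ_smul_dvd u (1 : C)
  simp only [smul_eq_mul, mul_one] at hy
  have hm : ∀ m : ℕ, u ^ (n + m) * y ^ m = u ^ n := by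
    intro m
    induction m with
    | zero => simp
    | succ m ih =>
      calc u ^ (n + (m + 1)) * y ^ (m + 1) = (u ^ n.succ * y) * (u ^ m * y ^ m) := by
            rw [Nat.succ_eq_add_one]
            ring
        _ = u ^ (n + m) * y ^ m := by
            rw [hy]
            ring
        _ = u ^ n := ih
  let N := n + 1
  let f := u ^ N * y ^ N
  have hN : u ^ N * f = u ^ N := by
    calc u ^ N * f = u * (u ^ (n + N) * y ^ N) := by
          simp only [f, N]
          ring
      _ = u ^ N := by
          rw [hm N]
          simp only [N]
          ring
  have hff : f * f = f := by
    calc f * f = (u ^ N * f) * y ^ N := by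
          simp only [f]
          ring
      _ = f := by rw [hN]
  have hdvd : (1 - u) ∣ 1 - u ^ N := by simpa using sub_dvd_pow_sub_pow (1 : C) u N
  obtain ⟨t, ht⟩ := hdvd
  have hef : (1 - u) * (t * (1 - f)) = 1 - f := by
    rw [← mul_assoc, ← ht]
    linear_combination hN
  refine ⟨t * (1 - f), ?_, ?_⟩
  · rw [hef]
    intro h
    apply hu
    refine IsUnit.of_mul_eq_one (u ^ n * y ^ N) ?_
    calc u * (u ^ n * y ^ N) = f := by
          simp only [f, N]
          ring
      _ = 1 := (sub_eq_zero.1 h).symm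
  · rw [hef]
    linear_combination hff

/-- In a finite-dimensional algebra, if `1 - r` is not a unit, then some multiple of `r` is a
non-zero idempotent. -/
lemma exists_idempotent_of_not_isUnit (k : Type*) [Field k] {R : Type*} [Ring R] [Algebra k R]
    [FiniteDimensional k R] {r : R} (hr : ¬ IsUnit (1 - r)) :
    ∃ t : R, t * r ≠ 0 ∧ (t * r) * (t * r) = t * r := by
  -- The subalgebra generated by 1 - r is commutative and finite-dimensional, and a unit in it would
  -- be a unit in R.
  have := Algebra.isMulCommutative_adjoin k (s := {1 - r}) (by simp)
  let : CommRing (Algebra.adjoin k {1 - r}) := inferInstance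
  have : IsArtinianRing (Algebra.adjoin k {1 - r}) :=
    IsArtinianRing.of_finite k _
  let u : Algebra.adjoin k {1 - r} := ⟨1 - r, Algebra.subset_adjoin rfl⟩
  have hu : ¬ IsUnit u := fun h => hr (h.map (Algebra.adjoin k {1 - r}).val)
  obtain ⟨t, h₀, h₁⟩ := exists_idempotent_of_commRing hu
  rw [mul_comm (1 - u) t] at h₀ h₁
  have e : ((t * (1 - u) : Algebra.adjoin k {1 - r}) : R) = t * r := by
    change (t : R) * (1 - (1 - r)) = t * r
    rw [sub_sub_cancel]
  refine ⟨t, fun h => h₀ (Subtype.ext (e.trans h)), ?_⟩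
  rw [← e]
  exact congrArg Subtype.val h₁

/-- A bilinear map which is non-degenerate on the right induces a surjection onto the dual. -/
lemma surjective_of_flip_injective {k V W : Type*} [Field k] [AddCommGroup V] [Module k V]
    [AddCommGroup W] [Module k W] [FiniteDimensional k V] [FiniteDimensional k W]
    (B : V →ₗ[k] W →ₗ[k] k) (h : Function.Injective B.flip) : Function.Surjective B :=
  LinearMap.flip_injective_iff₂.1 h

end LinearAlgebra

/-! ### Dimension arguments in a Hom-finite category -/

section Linear

variable (k : Type*) [Field k] {M : Type u} [Category.{v} M] [Preadditive M] [Linear k M]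
  [∀ X Y : M, FiniteDimensional k (X ⟶ Y)]

include k

/-- A one-sided inverse of an endomorphism in a `Hom`-finite category is two-sided. -/
lemma comp_eq_id_symm {X : M} {f g : X ⟶ X} (h : f ≫ g = 𝟙 X) : g ≫ f = 𝟙 X := by
  have hi : Function.Injective (Linear.rightComp k X f) := fun x y hxy => by
    have := congrArg (fun t => t ≫ g) hxy
    simpa [h] using this
  obtain ⟨x, hx⟩ := LinearMap.surjective_of_injective hi (𝟙 X)
  have hx : x ≫ f = 𝟙 X := hx
  have : x = g := by rw [← Category.comp_id x, ← h, reassoc_of% hx]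
  rw [← this, hx]

lemma isIso_of_comp_eq_id {X : M} {f g : X ⟶ X} (h : f ≫ g = 𝟙 X) : IsIso f :=
  ⟨g, h, comp_eq_id_symm k h⟩

lemma IsSplitMono.isIso_end {X : M} {f : X ⟶ X} (h : IsSplitMono f) : IsIso f :=
  isIso_of_comp_eq_id k (IsSplitMono.id f)

/-- A morphism outside the radical restricts to an isomorphism between non-zero summands. -/
lemma exists_comp_comp_eq_of_not_isRadical {X Y : M} {f : X ⟶ Y} (hf : ¬ IsRadical f) :
    ∃ s : Y ⟶ X, s ≫ f ≫ s = s ∧ f ≫ s ≠ 0 := by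
  unfold IsRadical at hf
  push Not at hf
  obtain ⟨g, hg⟩ := hf
  have : FiniteDimensional k (End X) := inferInstanceAs (FiniteDimensional k (X ⟶ X))
  have hu : ¬ IsUnit (1 - (show End X from f ≫ g)) := fun h => hg ((isUnit_iff_isIso _).1 h)
  obtain ⟨(t' : X ⟶ X), h₀, h₁⟩ := exists_idempotent_of_not_isUnit k hu
  -- Multiplication in `End X` reverses composition.
  have h₀ : (f ≫ g) ≫ t' ≠ 0 := h₀
  have h₁ : ((f ≫ g) ≫ t') ≫ ((f ≫ g) ≫ t') = (f ≫ g) ≫ t' := h₁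
  simp only [Category.assoc] at h₀ h₁
  -- With e = f ≫ g ≫ t' idempotent, s = g ≫ t' ≫ e satisfies f ≫ s = e.
  refine ⟨g ≫ t' ≫ f ≫ g ≫ t', ?_, ?_⟩
  · simp only [Category.assoc]
    rw [h₁, h₁]
  · rwa [h₁]

/-- The endomorphism algebra of a retract is no larger. -/
lemma finrank_end_le {X Y : M} {a : Y ⟶ X} {b : X ⟶ Y} (h : a ≫ b = 𝟙 Y) :
    Module.finrank k (Y ⟶ Y) ≤ Module.finrank k (X ⟶ X) := by
  refine LinearMap.finrank_le_finrank_of_injective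
    (f := (Linear.leftComp k X b) ∘ₗ (Linear.rightComp k Y a)) fun x y hxy => ?_
  have hxy : b ≫ x ≫ a = b ≫ y ≫ a := hxy
  simpa [h, reassoc_of% h] using congrArg (fun t => a ≫ t ≫ b) hxy

/-- The endomorphism algebra of a proper retract is smaller. -/
lemma finrank_end_lt {X Y : M} {a : Y ⟶ X} {b : X ⟶ Y} (h : a ≫ b = 𝟙 Y) (h' : b ≫ a ≠ 𝟙 X) :
    Module.finrank k (Y ⟶ Y) < Module.finrank k (X ⟶ X) := by
  refine lt_of_le_of_ne (finrank_end_le k h) fun he => h' ?_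
  let L := (Linear.leftComp k X b) ∘ₗ (Linear.rightComp k Y a)
  have hi : Function.Injective L := fun x y hxy => by
    have hxy : b ≫ x ≫ a = b ≫ y ≫ a := hxy
    simpa [h, reassoc_of% h] using congrArg (fun t => a ≫ t ≫ b) hxy
  obtain ⟨y, hy⟩ := (LinearMap.injective_iff_surjective_of_finrank_eq_finrank he).1 hi (𝟙 X)
  have hy : b ≫ y ≫ a = 𝟙 X := hy
  have : b ≫ a ≫ b ≫ y ≫ a = b ≫ y ≫ a := by rw [reassoc_of% h]
  rwa [hy, Category.comp_id] at this

/-- Let `δ : Z ⟶ X` be such that composition `Hom(Z, W) × Hom(W, X) ⟶ Hom(Z, X)` detects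
non-zero morphisms `W ⟶ X` by `δ` for `W` in `P`, and non-zero morphisms `Z ⟶ W` by `δ` through
`φ : W₀ ⟶ X`. Then `φ` is a precover. -/
lemma isPrecover_of_detects (P : ObjectProperty M) {Z X W₀ : M} (hW₀ : P W₀) (δ : Z ⟶ X)
    (hδ : δ ≠ 0) (φ : W₀ ⟶ X)
    (h₁ : ∀ W : M, P W → ∀ h : Z ⟶ W, h ≠ 0 → ∃ f : W ⟶ W₀, h ≫ f ≫ φ = δ)
    (h₂ : ∀ W : M, P W → ∀ f : W ⟶ X, f ≠ 0 → ∃ h : Z ⟶ W, h ≫ f = δ) :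
    IsPrecover P φ := by
  refine ⟨hW₀, fun W hW g => ?_⟩
  obtain ⟨η, hη⟩ := Module.Projective.exists_dual_ne_zero k hδ
  let B : (W ⟶ X) →ₗ[k] (Z ⟶ W) →ₗ[k] k := (Linear.comp Z W X).flip.compr₂ η
  let C : (W ⟶ W₀) →ₗ[k] (Z ⟶ W) →ₗ[k] k := B ∘ₗ Linear.rightComp k W φ
  have hB : Function.Injective B := by
    rw [injective_iff_map_eq_zero]
    intro f hf
    by_contra hne
    obtain ⟨h, hh⟩ := h₂ W hW f hne
    have : η (h ≫ f) = 0 := LinearMap.congr_fun hf h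
    exact hη (hh ▸ this)
  have hC : Function.Surjective C := by
    apply surjective_of_flip_injective
    rw [injective_iff_map_eq_zero]
    intro h hh
    by_contra hne
    obtain ⟨f, hf⟩ := h₁ W hW h hne
    have : η (h ≫ f ≫ φ) = 0 := LinearMap.congr_fun hh f
    exact hη (hf ▸ this)
  obtain ⟨f, hf⟩ := hC (B g)
  exact ⟨f, hB hf⟩

/-- Among the lifts of `δ` along `φ` there is one, `δ'`, such that every morphism that does not
annihilate `δ'` can be continued to an endomorphism that fixes `δ'`, provided that every morphism
that does not annihilate a lift can be continued to `δ` through `φ`. -/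
lemma exists_lift_minimal (P : ObjectProperty M) {Z X W₀ : M} (δ : Z ⟶ X) (φ : W₀ ⟶ X)
    (h₀ : ∃ δ' : Z ⟶ W₀, δ' ≫ φ = δ)
    (h₁ : ∀ W : M, P W → ∀ h : Z ⟶ W, h ≠ 0 → ∃ f : W ⟶ W₀, h ≫ f ≫ φ = δ) :
    ∃ δ' : Z ⟶ W₀, δ' ≫ φ = δ ∧ ∀ W : M, P W → ∀ a : W₀ ⟶ W, δ' ≫ a ≠ 0 →
      ∃ s : W ⟶ W₀, δ' ≫ a ≫ s = δ' := by
  -- The rank of x is the dimension of the space of composites of x with endomorphisms of W₀.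
  -- Continuing a lift shrinks this space; if the result is again a lift, minimality gives equality,
  -- so the original lift is recovered.
  let r : (Z ⟶ W₀) → ℕ := fun x => Module.finrank k (LinearMap.range (Linear.leftComp k W₀ x))
  obtain ⟨δ', hδ', hmin⟩ := (measure r).wf.has_min {x | x ≫ φ = δ} h₀
  refine ⟨δ', hδ', fun W hW a ha => ?_⟩
  obtain ⟨f, hf⟩ := h₁ W hW _ ha
  have hle : LinearMap.range (Linear.leftComp k W₀ (δ' ≫ a ≫ f)) ≤
      LinearMap.range (Linear.leftComp k W₀ δ') := by
    rintro _ ⟨x, rfl⟩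
    exact ⟨a ≫ f ≫ x, by simp⟩
  have heq := Submodule.eq_of_le_of_finrank_le hle
    (not_lt.1 (hmin (δ' ≫ a ≫ f) (by simpa using hf)))
  have hmem : δ' ∈ LinearMap.range (Linear.leftComp k W₀ δ') := ⟨𝟙 _, by simp⟩
  rw [← heq] at hmem
  obtain ⟨x, hx⟩ := hmem
  exact ⟨f ≫ x, by simpa using hx⟩

end Linear

/-! ### Cutting off contractible summands to make the middle maps radical -/

section Splitting

variable {M : Type u} [Category.{v} M]

namespace SigmaSequence

variable {S : M ⥤ M} {d : ℕ}

/-- The sequence obtained by transport along morphisms `a` to and `b` from the objects. -/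
def restrict (T : SigmaSequence S d) {Y : Fin (d + 2) → M} (a : ∀ i, Y i ⟶ T.obj i)
    (b : ∀ i, T.obj i ⟶ Y i) : SigmaSequence S d where
  obj := Y
  map i := a i.castSucc ≫ T.map i ≫ b i.succ
  last := a (Fin.last (d + 1)) ≫ T.last ≫ S.map (b 0)

section

variable {T : SigmaSequence S d} {Y : Fin (d + 2) → M} {a : ∀ i, Y i ⟶ T.obj i}
  {b : ∀ i, T.obj i ⟶ Y i} (E : Hom T T)

/-- The inclusion of the sequence cut out by a split idempotent. -/
def restrictIncl (hab : ∀ i, a i ≫ b i = 𝟙 _) (hba : ∀ i, b i ≫ a i = E.hom i) :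
    Hom (T.restrict a b) T where
  hom := a
  comm i := by
    change (a i.castSucc ≫ T.map i ≫ b i.succ) ≫ a i.succ = a i.castSucc ≫ T.map i
    rw [Category.assoc, Category.assoc, hba, E.comm, ← hba, Category.assoc, reassoc_of% (hab i.castSucc)]
  comm_last := by
    change (a (Fin.last (d + 1)) ≫ T.last ≫ S.map (b 0)) ≫ S.map (a 0) =
      a (Fin.last (d + 1)) ≫ T.last
    rw [Category.assoc, Category.assoc, ← S.map_comp, hba, E.comm_last, ← hba,
      Category.assoc, reassoc_of% (hab (Fin.last (d + 1)))]

/-- The projection to the sequence cut out by a split idempotent. -/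
def restrictProj (hab : ∀ i, a i ≫ b i = 𝟙 _) (hba : ∀ i, b i ≫ a i = E.hom i) :
    Hom T (T.restrict a b) where
  hom := b
  comm i := by
    change T.map i ≫ b i.succ = b i.castSucc ≫ a i.castSucc ≫ T.map i ≫ b i.succ
    rw [reassoc_of% (hba i.castSucc), ← reassoc_of% (E.comm i), ← hba, Category.assoc,
      hab, Category.comp_id]
  comm_last := by
    change T.last ≫ S.map (b 0) =
      b (Fin.last (d + 1)) ≫ a (Fin.last (d + 1)) ≫ T.last ≫ S.map (b 0)
    rw [reassoc_of% (hba (Fin.last (d + 1))), ← reassoc_of% E.comm_last, ← S.map_comp,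
      ← hba, Category.assoc, hab, Category.comp_id]

end

variable [Preadditive M]

/-- The complement of an endomorphism of a sequence. -/
def Hom.compl [S.Additive] {T : SigmaSequence S d} (E : Hom T T) : Hom T T where
  hom i := 𝟙 _ - E.hom i
  comm i := by simp [Preadditive.comp_sub, Preadditive.sub_comp, E.comm]
  comm_last := by simp [Preadditive.comp_sub, Preadditive.sub_comp, E.comm_last]

end SigmaSequence

lemma comp_map_comp_eq (S : M ⥤ M) {Z₁ X₁ Z X Z' X' : M} (l : Z₁ ⟶ S.obj X₁) (a : X₁ ⟶ X)
    (c : Z₁ ⟶ Z) (t : Z ⟶ S.obj X) (e₀ : X ⟶ X') (e₁ : Z ⟶ Z') (δ : Z' ⟶ S.obj X')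
    (h : l ≫ S.map a = c ≫ t) (he : t ≫ S.map e₀ = e₁ ≫ δ) :
    l ≫ S.map (a ≫ e₀) = (c ≫ e₁) ≫ δ := by
  rw [S.map_comp, reassoc_of% h, he, Category.assoc]

/-- The square just before the modified ones in `exists_hom_compl_nullHomotopic`; the primed version
is the square just after. -/
lemma comm_of_comp_eq_zero [Preadditive M] {A B C : M} (f : A ⟶ B) (g : B ⟶ C) (s : C ⟶ B)
    (h : f ≫ g = 0) (E' : A ⟶ A) (E : B ⟶ B) (hE' : E' = 𝟙 A) (hE : E = 𝟙 B - g ≫ s) :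
    f ≫ E = E' ≫ f := by
  simp [hE, hE', Preadditive.comp_sub, reassoc_of% h]

lemma comm_of_comp_eq_zero' [Preadditive M] {A B C : M} (f : A ⟶ B) (g : B ⟶ C) (s : B ⟶ A)
    (h : f ≫ g = 0) (E : B ⟶ B) (E' : C ⟶ C) (hE' : E' = 𝟙 C) (hE : E = 𝟙 B - s ≫ f) :
    g ≫ E' = E ≫ g := by
  simp [hE, hE', Preadditive.sub_comp, h]

variable [Preadditive M] [HasZeroObject M] [HasBinaryBiproducts M]
  {S : M ⥤ M} [S.IsEquivalence] {d : ℕ}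

namespace Angulation

open SigmaSequence

/-- A split idempotent endomorphism of an angle cuts out an angle. -/
lemma restrict_mem (A : Angulation S d) [IsIdempotentComplete M] {T : SigmaSequence S d}
    (hT : T ∈ A.angles) (E : Hom T T) {Y : Fin (d + 2) → M} {a : ∀ i, Y i ⟶ T.obj i}
    {b : ∀ i, T.obj i ⟶ Y i} (hab : ∀ i, a i ≫ b i = 𝟙 _) (hba : ∀ i, b i ≫ a i = E.hom i) :
    T.restrict a b ∈ A.angles := by
  have := additive_of_isEquivalence S
  have hE : ∀ i, E.hom i ≫ E.hom i = E.hom i := fun i => by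
    rw [← hba, Category.assoc, reassoc_of% (hab i)]
  have h := fun i => IsIdempotentComplete.idempotents_split (T.obj i) (𝟙 _ - E.hom i) (by
    simp [Preadditive.comp_sub, Preadditive.sub_comp, hE])
  choose Y' a' b' hab' hba' using h
  have hba' : ∀ i, b' i ≫ a' i = E.compl.hom i := hba'
  refine ((A.mem_iff_of_isDirectSum T (T.restrict a b) (T.restrict a' b')
    ⟨restrictIncl E hab hba, restrictIncl E.compl hab' hba', restrictProj E hab hba,
      restrictProj E.compl hab' hba', fun i => ⟨hab i, hab' i, ?_, ?_, ?_⟩⟩).1 hT).1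
  · change a i ≫ b' i = 0
    have h : (a i ≫ b' i) ≫ a' i = 0 := by
      rw [Category.assoc, hba']
      change a i ≫ (𝟙 _ - E.hom i) = 0
      rw [← hba, Preadditive.comp_sub, reassoc_of% (hab i), Category.comp_id, sub_self]
    simpa [hab'] using congrArg (fun t => t ≫ b' i) h
  · change a' i ≫ b i = 0
    have h : (a' i ≫ b i) ≫ a i = 0 := by
      have e : E.hom i = 𝟙 _ - b' i ≫ a' i := by
        rw [hba']
        exact (sub_sub_cancel _ _).symm
      rw [Category.assoc, hba, e, Preadditive.comp_sub, reassoc_of% (hab' i),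
        Category.comp_id, sub_self]
    simpa [hab] using congrArg (fun t => t ≫ b i) h
  · change b i ≫ a i + b' i ≫ a' i = 𝟙 _
    rw [hba, hba']
    exact add_sub_cancel _ _

/-- The endomorphism of an angle which is the complement of the null-homotopic endomorphism
given by a morphism `s` against the direction of `ξ^i`. -/
lemma exists_hom_compl_nullHomotopic (A : Angulation S d) {T : SigmaSequence S d}
    (hT : T ∈ A.angles) {i : Fin (d + 1)} (hi₀ : i ≠ 0) (hi₁ : i ≠ Fin.last d)
    (s : T.obj i.succ ⟶ T.obj i.castSucc) :
    ∃ E : Hom T T, E.hom i.castSucc = 𝟙 _ - T.map i ≫ s ∧ E.hom i.succ = 𝟙 _ - s ≫ T.map i ∧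
      ∀ j, j ≠ i.castSucc → j ≠ i.succ → E.hom j = 𝟙 _ := by
  let e : ∀ j, T.obj j ⟶ T.obj j := Function.update (Function.update (fun j => 𝟙 (T.obj j))
    i.castSucc (𝟙 _ - T.map i ≫ s)) i.succ (𝟙 _ - s ≫ T.map i)
  have hne : i.castSucc ≠ i.succ := (Fin.castSucc_lt_succ).ne
  have e₀ : e i.castSucc = 𝟙 _ - T.map i ≫ s := by
    simp only [e]
    rw [Function.update_of_ne hne, Function.update_self]
  have e₁ : e i.succ = 𝟙 _ - s ≫ T.map i := Function.update_self ..
  have e₂ : ∀ j, j ≠ i.castSucc → j ≠ i.succ → e j = 𝟙 _ := fun j h h' => by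
    simp only [e]
    rw [Function.update_of_ne h', Function.update_of_ne h]
  clear_value e
  refine ⟨⟨e, fun j => ?_, ?_⟩, e₀, e₁, e₂⟩
  · by_cases hj : j = i
    · subst hj
      rw [e₀, e₁]
      simp [Preadditive.comp_sub, Preadditive.sub_comp]
    by_cases h₁ : j.succ = i.castSucc
    · have h₁' : j.val + 1 = i.val := congrArg Fin.val h₁
      obtain ⟨p, rfl⟩ : ∃ p : Fin d, p.castSucc = j := ⟨⟨j, by omega⟩, rfl⟩
      obtain rfl : p.succ = i := Fin.ext h₁'
      refine comm_of_comp_eq_zero _ _ _ (A.map_comp_map p T hT) _ _ (e₂ _ ?_ ?_) e₀ <;>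
        (simp only [ne_eq, Fin.ext_iff, Fin.val_succ, Fin.val_castSucc]; omega)
    by_cases h₂ : j.castSucc = i.succ
    · have h₂' : j.val = i.val + 1 := congrArg Fin.val h₂
      obtain ⟨p, rfl⟩ : ∃ p : Fin d, p.castSucc = i := ⟨⟨i, by omega⟩, rfl⟩
      obtain rfl : p.succ = j := Fin.ext h₂'.symm
      refine comm_of_comp_eq_zero' _ _ _ (A.map_comp_map p T hT) _ _ (e₂ _ ?_ ?_) e₁ <;>
        (simp only [ne_eq, Fin.ext_iff, Fin.val_succ, Fin.val_castSucc]; omega)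
    rw [e₂ j.succ h₁ (fun h => hj (Fin.succ_injective _ h)),
      e₂ j.castSucc (fun h => hj (Fin.castSucc_injective _ h)) h₂, Category.comp_id,
      Category.id_comp]
  · rw [e₂ 0 (fun h => hi₀ ?_) (Fin.succ_ne_zero i).symm,
      e₂ (Fin.last (d + 1)) (Fin.castSucc_lt_last i).ne' (fun h => hi₁ ?_), S.map_id,
      Category.comp_id, Category.id_comp]
    · exact Fin.succ_injective _ (h.symm.trans (Fin.succ_last d).symm)
    · exact Fin.castSucc_injective _ h.symm

/-- A morphism to the suspension of an object is the last morphism of an angle whose middle terms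
lie in a subcategory that is closed under extensions, and whose middle maps are radical. -/
lemma exists_radical_angle (k : Type*) [Field k] [Linear k M]
    [∀ X Y : M, FiniteDimensional k (X ⟶ Y)] [IsIdempotentComplete M] (A : Angulation S d)
    {P : ObjectProperty M} (hP : IsAdditiveSubcategory P) (hPext : ClosedUnderExtensions A P)
    {W' W'' : M} (h' : P W') (h'' : P W'') (δ : W'' ⟶ S.obj W') :
    ∃ T ∈ A.angles, (∀ i, P (T.obj i)) ∧
      (∃ (e₀ : T.obj 0 ≅ W') (e₁ : T.obj (Fin.last (d + 1)) ≅ W''),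
        T.last ≫ S.map e₀.hom = e₁.hom ≫ δ) ∧
      ∀ i : Fin (d + 1), i ≠ 0 → i ≠ Fin.last d → IsRadical (T.map i) := by
  -- Closure under retracts: splitting the complementary idempotent turns a retract into a biproduct
  -- summand.
  have hsummand : ∀ {X Y : M} (a : Y ⟶ X) (b : X ⟶ Y), a ≫ b = 𝟙 Y → P X → P Y := by
    intro X Y a b hab hX
    obtain ⟨Z, a', b', hab', hba'⟩ := IsIdempotentComplete.idempotents_split X (𝟙 X - b ≫ a) (by
      simp [Preadditive.comp_sub, Preadditive.sub_comp, reassoc_of% hab])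
    have h₁ : a ≫ b' = 0 := by
      have : (a ≫ b') ≫ a' = 0 := by
        rw [Category.assoc, hba', Preadditive.comp_sub, reassoc_of% hab, Category.comp_id,
          sub_self]
      simpa [hab'] using congrArg (fun t => t ≫ b') this
    have h₂ : a' ≫ b = 0 := by
      have e : a' ≫ b' ≫ a' = a' := by rw [reassoc_of% hab']
      rw [hba', Preadditive.comp_sub, Category.comp_id, sub_eq_self] at e
      simpa [hab] using congrArg (fun t => t ≫ b) e
    let ι : X ≅ Y ⊞ Z :=
      { hom := biprod.lift b b'
        inv := biprod.desc a a'
        hom_inv_id := by simp [hba']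
        inv_hom_id := by ext <;> simp [hab, hab', h₁, h₂] }
    exact (hP.summand (hP.of_iso ι hX)).1
  -- An angle of least total endomorphism dimension works: a non-radical middle map would allow a
  -- non-zero contractible summand to be removed without changing the ends.
  let r : SigmaSequence S d → ℕ := fun T => ∑ i, Module.finrank k (T.obj i ⟶ T.obj i)
  let C : Set (SigmaSequence S d) := {T | T ∈ A.angles ∧ (∀ i, P (T.obj i)) ∧
    ∃ (e₀ : T.obj 0 ≅ W') (e₁ : T.obj (Fin.last (d + 1)) ≅ W''),
      T.last ≫ S.map e₀.hom = e₁.hom ≫ δ}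
  have hC : C.Nonempty := by
    obtain ⟨T, hT, e₀, e₁, he, hi⟩ := hPext W' W'' h' h'' δ
    refine ⟨T, hT, fun i => ?_, e₀, e₁, he⟩
    by_cases hi₀ : i = 0
    · exact hi₀ ▸ hP.of_iso e₀.symm h'
    by_cases hi₁ : i = Fin.last (d + 1)
    · exact hi₁ ▸ hP.of_iso e₁.symm h''
    exact hi i hi₀ hi₁
  obtain ⟨T, ⟨hT, hTP, e₀, e₁, he⟩, hmin⟩ := (measure r).wf.has_min C hC
  refine ⟨T, hT, hTP, ⟨e₀, e₁, he⟩, fun i hi₀ hi₁ => ?_⟩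
  by_contra hrad
  obtain ⟨s, hs, hne⟩ := exists_comp_comp_eq_of_not_isRadical k hrad
  obtain ⟨E, hE₀, hE₁, hE₂⟩ := A.exists_hom_compl_nullHomotopic hT hi₀ hi₁ s
  have hidem : ∀ j, E.hom j ≫ E.hom j = E.hom j := by
    intro j
    by_cases h₀ : j = i.castSucc
    · subst h₀
      rw [hE₀]
      simp [Preadditive.comp_sub, Preadditive.sub_comp, hs]
    by_cases h₁ : j = i.succ
    · subst h₁
      rw [hE₁]
      simp [Preadditive.comp_sub, Preadditive.sub_comp, reassoc_of% hs]
    rw [hE₂ j h₀ h₁, Category.comp_id]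
  have h := fun j => IsIdempotentComplete.idempotents_split (T.obj j) (E.hom j) (hidem j)
  choose Y a b hab hba using h
  have hEz : E.hom 0 = 𝟙 _ := hE₂ 0
    (fun h => hi₀ (Fin.castSucc_injective _ h.symm)) (Fin.succ_ne_zero i).symm
  have hEl : E.hom (Fin.last (d + 1)) = 𝟙 _ := hE₂ _ (Fin.castSucc_lt_last i).ne'
    (fun h => hi₁ (Fin.succ_injective _ (h.symm.trans (Fin.succ_last d).symm)))
  refine hmin (T.restrict a b) ⟨A.restrict_mem hT E hab hba,
    fun j => hsummand (a j) (b j) (hab j) (hTP j),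
    Iso.mk (a 0) (b 0) (hab 0) ((hba 0).trans hEz) ≪≫ e₀,
    Iso.mk (a _) (b _) (hab _) ((hba _).trans hEl) ≪≫ e₁, ?_⟩ ?_
  · have h := (restrictIncl E hab hba).comm_last
    change (T.restrict a b).last ≫ S.map (a 0) = a (Fin.last (d + 1)) ≫ T.last at h
    exact comp_map_comp_eq S _ _ _ _ _ _ _ h he
  · refine Finset.sum_lt_sum (fun j _ => finrank_end_le k (hab j))
      ⟨i.castSucc, Finset.mem_univ _, finrank_end_lt k (hab _) fun h => hne ?_⟩
    rw [hba, hE₀, sub_eq_self] at h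
    exact h

end Angulation

end Splitting

/-! ### Almost split morphisms, local endomorphism rings and socle elements -/

section AlmostSplit

variable {M : Type u} [Category.{v} M]

lemma isSplitEpi_of_comp {X Y Z : M} {f : X ⟶ Y} {g : Y ⟶ Z} (h : IsSplitEpi (f ≫ g)) :
    IsSplitEpi g :=
  ⟨⟨⟨section_ (f ≫ g) ≫ f, by rw [Category.assoc, IsSplitEpi.id]⟩⟩⟩

lemma isSplitMono_of_comp {X Y Z : M} {f : X ⟶ Y} {g : Y ⟶ Z} (h : IsSplitMono (f ≫ g)) :
    IsSplitMono f :=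
  ⟨⟨⟨g ≫ retraction (f ≫ g), by rw [← Category.assoc, IsSplitMono.id]⟩⟩⟩

lemma isSplitEpi_of_comp_iso {X Y Z : M} {f : X ⟶ Y} (e : Y ≅ Z) (h : IsSplitEpi (f ≫ e.hom)) :
    IsSplitEpi f :=
  ⟨⟨⟨e.hom ≫ section_ (f ≫ e.hom), by
    rw [← cancel_mono e.hom, Category.assoc, Category.assoc, IsSplitEpi.id]
    simp⟩⟩⟩

lemma isSplitMono_of_iso_comp {X Y Z : M} {f : Y ⟶ Z} (e : X ≅ Y) (h : IsSplitMono (e.hom ≫ f)) :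
    IsSplitMono f :=
  ⟨⟨⟨retraction (e.hom ≫ f) ≫ e.hom, by
    rw [← cancel_epi e.hom, ← Category.assoc, ← Category.assoc, IsSplitMono.id]
    simp⟩⟩⟩

variable [Preadditive M]

/-- The source of a left almost split morphism has a local endomorphism ring. -/
lemma IsLeftAlmostSplit.isSplitMono_or {P : ObjectProperty M} {X Y : M} {f : X ⟶ Y}
    (hf : IsLeftAlmostSplit P f) (hX : P X) (g : X ⟶ X) :
    IsSplitMono g ∨ IsSplitMono (𝟙 X - g) := by
  by_contra! h
  obtain ⟨a, ha⟩ := hf.2 X hX g h.1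
  obtain ⟨b, hb⟩ := hf.2 X hX _ h.2
  exact hf.1 ⟨⟨⟨a + b, by rw [Preadditive.comp_add, ha, hb, add_sub_cancel]⟩⟩⟩

/-- The target of a right almost split morphism has a local endomorphism ring. -/
lemma IsRightAlmostSplit.isSplitEpi_or {P : ObjectProperty M} {X Y : M} {f : X ⟶ Y}
    (hf : IsRightAlmostSplit P f) (hY : P Y) (g : Y ⟶ Y) :
    IsSplitEpi g ∨ IsSplitEpi (𝟙 Y - g) := by
  by_contra! h
  obtain ⟨a, ha⟩ := hf.2 Y hY g h.1
  obtain ⟨b, hb⟩ := hf.2 Y hY _ h.2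
  exact hf.1 ⟨⟨⟨a + b, by rw [Preadditive.add_comp, ha, hb, add_sub_cancel]⟩⟩⟩

/-- A non-zero morphism from an object with local endomorphism ring is right minimal. -/
lemma isRightMinimal_of_local {X Y : M} (hX : ∀ x : X ⟶ X, IsIso x ∨ IsIso (𝟙 X - x))
    {f : X ⟶ Y} (hf : f ≠ 0) : IsRightMinimal f := fun g hg => by
  refine (hX g).resolve_right fun h => hf ?_
  rw [← cancel_epi (𝟙 X - g), Preadditive.sub_comp, hg, Category.id_comp, sub_self, comp_zero]

/-- `δ : Z ⟶ V` is annihilated by all morphisms from objects of `P` to `Z` that are not split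
epimorphisms. -/
def IsSocle (P : ObjectProperty M) {Z V : M} (δ : Z ⟶ V) : Prop :=
  ∀ W : M, P W → ∀ g : W ⟶ Z, ¬ IsSplitEpi g → g ≫ δ = 0

lemma IsSocle.comp {P : ObjectProperty M} {Z V V' : M} {δ : Z ⟶ V} (hδ : IsSocle P δ)
    (f : V ⟶ V') : IsSocle P (δ ≫ f) := fun W hW g hg => by
  rw [reassoc_of% (hδ W hW g hg), zero_comp]

lemma IsSocle.iso_inv_comp {P : ObjectProperty M} {Z Z' V : M} {δ : Z ⟶ V} (hδ : IsSocle P δ)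
    (e : Z ≅ Z') : IsSocle P (e.inv ≫ δ) := fun W hW g hg => by
  rw [← Category.assoc]
  exact hδ W hW _ fun h => hg (isSplitEpi_of_comp_iso e.symm h)

end AlmostSplit

/-! ### The two factorisation properties behind the pairing -/

section Angles

variable {M : Type u} [Category.{v} M] [Preadditive M] [HasZeroObject M] [HasBinaryBiproducts M]
  {S : M ⥤ M} [S.IsEquivalence] {d : ℕ}

namespace Angulation

open SigmaSequence

variable (A : Angulation S d) {P : ObjectProperty M}

/-- The last morphism of an angle whose penultimate morphism is right almost split is a socle
element. -/
lemma isSocle_last (hd : 1 ≤ d) {T : SigmaSequence S d} (hT : T ∈ A.angles)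
    (hr : IsRightAlmostSplit P T.final) : IsSocle P T.last := fun W hW g hg => by
  obtain ⟨h, rfl⟩ := hr.2 W hW g hg
  rw [Category.assoc, A.final_comp_last hd hT, comp_zero]

lemma last_ne_zero {T : SigmaSequence S d} (hT : T ∈ A.angles)
    (hr : IsRightAlmostSplit P T.final) : T.last ≠ 0 := fun h => by
  obtain ⟨g, hg⟩ := A.exists_comp_final_eq hT (𝟙 _) (by rw [h, comp_zero])
  exact hr.1 ⟨⟨⟨g, hg⟩⟩⟩

/-- Every non-zero morphism `Z ⟶ Σ^d W` with `W` in `P` can be continued to a socle element. -/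
lemma exists_comp_map_eq_of_isSocle (hd : 1 ≤ d) (hPext : ClosedUnderExtensions A P)
    {Z X W : M} (hZ : P Z) (hW : P W) {δ : Z ⟶ S.obj X} (hδ : IsSocle P δ)
    (h : Z ⟶ S.obj W) (hne : h ≠ 0) : ∃ f : W ⟶ X, h ≫ S.map f = δ := by
  obtain ⟨T, hT, e₀, e₁, he, hi⟩ := hPext W Z hW hZ h
  have hh : h = e₁.inv ≫ T.last ≫ S.map e₀.hom := by rw [he, Iso.inv_hom_id_assoc]
  -- For d ≥ 1 the object X^d is a middle term.
  have hP : P (T.obj (Fin.last d).castSucc) := by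
    refine hi _ (fun h => ?_) (Fin.castSucc_lt_last _).ne
    have : d = 0 := congrArg Fin.val h
    omega
  have hg : ¬ IsSplitEpi (T.final ≫ e₁.hom) := fun hs => hne <| by
    have hz : (T.final ≫ e₁.hom) ≫ h = 0 := by
      rw [Category.assoc, ← he, reassoc_of% (A.final_comp_last hd hT), zero_comp]
    rwa [← cancel_epi (T.final ≫ e₁.hom), comp_zero]
  obtain ⟨f, hf⟩ := A.exists_last_comp_eq hT (e₁.hom ≫ δ) (by
    rw [← Category.assoc]
    exact hδ _ hP _ hg)
  refine ⟨e₀.inv ≫ f, ?_⟩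
  rw [hh, Category.assoc, Category.assoc, ← S.map_comp, Iso.hom_inv_id_assoc, hf,
    Iso.inv_hom_id_assoc]

/-- If the first morphism of an angle is left almost split in the whole category, then for every
non-zero morphism `f` to its source the last morphism factors through `Σ^d f`. -/
lemma exists_comp_map_eq_last (hd : 1 ≤ d) {T : SigmaSequence S d} (hT : T ∈ A.angles)
    (hl : IsLeftAlmostSplit ⊤ T.first) {W : M} (f : W ⟶ T.obj 0) (hf : f ≠ 0) :
    ∃ h : T.obj (Fin.last (d + 1)) ⟶ S.obj W, h ≫ S.map f = T.last := by
  have := additive_of_isEquivalence S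
  obtain ⟨C, c, hc, H⟩ := exists_weakCokernel hd A f
  -- Since f is non-zero, c is not a split monomorphism, so it factors through ξ^0 and Σ^d c
  -- annihilates the last morphism.
  obtain ⟨t, rfl⟩ := hl.2 C trivial c fun hs => hf <| by
    rwa [← cancel_mono c, zero_comp]
  exact H _ _ (by rw [S.map_comp, reassoc_of% (A.last_comp_first hd hT), zero_comp])

end Angulation

end Angles

/-! ### Precovers, minimal lifts and Auslander–Reiten angles in the subcategory -/

section Main

variable (k : Type*) [Field k] {M : Type u} [Category.{v} M] [Preadditive M] [HasZeroObject M]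
  [HasBinaryBiproducts M] [Linear k M] [∀ X Y : M, FiniteDimensional k (X ⟶ Y)]
  {S : M ⥤ M} [S.IsEquivalence] {d : ℕ} (A : Angulation S d) {P : ObjectProperty M}

namespace Angulation

open SigmaSequence

include k

/-- A morphism `φ : W₀ ⟶ X` along which `δ : Z ⟶ Σ^d X` lifts to a socle element is a precover
if `δ` factors through `Σ^d f` for each non-zero morphism `f : W ⟶ X`. -/
lemma isPrecover_of_isSocle (hd : 1 ≤ d) (hPext : ClosedUnderExtensions A P) {Z X W₀ : M}
    (hZ : P Z) (hW₀ : P W₀) {δ : Z ⟶ S.obj X} (hδ : δ ≠ 0)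
    (hfac : ∀ (W : M) (f : W ⟶ X), f ≠ 0 → ∃ h : Z ⟶ S.obj W, h ≫ S.map f = δ)
    {δ' : Z ⟶ S.obj W₀} (hδ' : IsSocle P δ') (φ : W₀ ⟶ X) (hφ : δ' ≫ S.map φ = δ) :
    IsPrecover P φ := by
  have := additive_of_isEquivalence S
  -- Replacing Z by a preimage under Σ^d turns the pairing into composition in M, so Σ^d need not be
  -- k-linear.
  let κ : S.obj (S.objPreimage Z) ≅ Z := S.objObjPreimageIso Z
  obtain ⟨δ₀, hδ₀⟩ := S.map_surjective (κ.hom ≫ δ)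
  refine isPrecover_of_detects k P hW₀ δ₀ (fun h => hδ ?_) φ (fun W hW h hh => ?_)
    (fun W _ f hf => ?_)
  · rw [h, S.map_zero] at hδ₀
    rw [← cancel_epi κ.hom, ← hδ₀, comp_zero]
  · obtain ⟨f, hf⟩ := A.exists_comp_map_eq_of_isSocle hd hPext hZ hW hδ' (κ.inv ≫ S.map h)
      fun h0 => hh <| S.map_injective <| by
        rw [← cancel_epi κ.inv, h0, S.map_zero, comp_zero]
    refine ⟨f, S.map_injective ?_⟩
    rw [hδ₀, ← hφ, ← hf]
    simp
  · obtain ⟨h, hh⟩ := hfac W f hf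
    obtain ⟨h₀, hh₀⟩ := S.map_surjective (κ.hom ≫ h)
    refine ⟨h₀, S.map_injective ?_⟩
    rw [S.map_comp, hh₀, hδ₀, Category.assoc, hh]

/-- A lift `δ'` of a socle element `δ` along a precover `φ` such that each morphism that does not
annihilate `δ'` can be continued to an endomorphism that fixes `δ'`. -/
lemma exists_lift_of_isPrecover (hd : 1 ≤ d) (hPext : ClosedUnderExtensions A P) {Z X W₀ : M}
    (hZ : P Z) {δ : Z ⟶ S.obj X} (hδ : IsSocle P δ) {φ : W₀ ⟶ X} (hφ : IsPrecover P φ)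
    {U : M} (hU : P U) {γ : Z ⟶ S.obj U} (hγ : γ ≠ 0) :
    ∃ δ' : Z ⟶ S.obj W₀, δ' ≫ S.map φ = δ ∧ ∀ W : M, P W → ∀ a : W₀ ⟶ W,
      δ' ≫ S.map a ≠ 0 → ∃ s : W ⟶ W₀, δ' ≫ S.map (a ≫ s) = δ' := by
  have := additive_of_isEquivalence S
  let κ : S.obj (S.objPreimage Z) ≅ Z := S.objObjPreimageIso Z
  obtain ⟨δ₀, hδ₀⟩ := S.map_surjective (κ.hom ≫ δ)
  have hlift : ∀ W : M, P W → ∀ h : Z ⟶ S.obj W, h ≠ 0 →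
      ∃ f : W ⟶ W₀, h ≫ S.map (f ≫ φ) = δ := fun W hW h hh => by
    obtain ⟨g, hg⟩ := A.exists_comp_map_eq_of_isSocle hd hPext hZ hW hδ h hh
    obtain ⟨f, rfl⟩ := hφ.2 W hW g
    exact ⟨f, hg⟩
  obtain ⟨δ₁, hδ₁, H⟩ := exists_lift_minimal k P δ₀ φ (by
    obtain ⟨u, hu⟩ := hlift U hU γ hγ
    obtain ⟨δ₁, hδ₁⟩ := S.map_surjective (κ.hom ≫ γ ≫ S.map u)
    refine ⟨δ₁, S.map_injective ?_⟩
    rw [S.map_comp, hδ₁, hδ₀, ← hu]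
    simp) (fun W hW h hh => by
    obtain ⟨f, hf⟩ := hlift W hW (κ.inv ≫ S.map h) fun h0 => hh <| S.map_injective <| by
      rw [← cancel_epi κ.inv, h0, S.map_zero, comp_zero]
    refine ⟨f, S.map_injective ?_⟩
    rw [hδ₀, ← hf]
    simp)
  refine ⟨κ.inv ≫ S.map δ₁, ?_, fun W hW a ha => ?_⟩
  · rw [Category.assoc, ← S.map_comp, hδ₁, hδ₀, Iso.inv_hom_id_assoc]
  · obtain ⟨s, hs⟩ := H W hW a fun h0 => ha <| by
      rw [Category.assoc, ← S.map_comp, h0, S.map_zero, comp_zero]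
    exact ⟨s, by rw [Category.assoc, ← S.map_comp, hs]⟩

omit k in
/-- If `Z` has a local endomorphism ring and `δ' : Z ⟶ Σ^d W₀` is non-zero and such that each
morphism that does not annihilate `δ'` can be continued to an endomorphism that fixes `δ'`, then
`δ'` is a socle element. -/
lemma isSocle_of_minimal (hd : 1 ≤ d) (hPext : ClosedUnderExtensions A P) {Z W₀ : M}
    (hW₀ : P W₀) (hlocal : ∀ x : Z ⟶ Z, IsSplitEpi x ∨ IsSplitEpi (𝟙 Z - x))
    {δ' : Z ⟶ S.obj W₀} (hδ' : δ' ≠ 0)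
    (hmin : ∀ W : M, P W → ∀ a : W₀ ⟶ W, δ' ≫ S.map a ≠ 0 →
      ∃ s : W ⟶ W₀, δ' ≫ S.map (a ≫ s) = δ') : IsSocle P δ' := by
  intro W hW g hg
  by_contra hne
  obtain ⟨T, hT, e₀, e₁, he, hi⟩ := hPext W₀ W hW₀ hW (g ≫ δ')
  have hP : P (T.obj (0 : Fin (d + 1)).succ) := by
    refine hi _ (Fin.succ_ne_zero _) (fun h => ?_)
    have : 0 + 1 = d + 1 := congrArg Fin.val h
    omega
  -- If the first map annihilates δ', then δ' factors through g ≫ δ', giving an endomorphism of Z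
  -- through g that fixes δ'. Otherwise δ' is recovered after the first map, which annihilates g ≫
  -- δ'.
  by_cases ha : δ' ≫ S.map (e₀.inv ≫ T.first) = 0
  · obtain ⟨t, ht⟩ := A.exists_comp_last_eq hT (δ' ≫ S.map e₀.inv) (by
      rw [Category.assoc, ← S.map_comp, ha])
    have hx : (t ≫ e₁.hom ≫ g) ≫ δ' = δ' := by
      rw [Category.assoc, Category.assoc, ← he, reassoc_of% ht, ← S.map_comp, Iso.inv_hom_id,
        S.map_id, Category.comp_id]
    obtain h | h := hlocal (t ≫ e₁.hom ≫ g)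
    · rw [← Category.assoc] at h
      exact hg (isSplitEpi_of_comp h)
    · apply hδ'
      rw [← cancel_epi (𝟙 Z - t ≫ e₁.hom ≫ g), Preadditive.sub_comp, hx, Category.id_comp,
        sub_self, comp_zero]
  · obtain ⟨s, hs⟩ := hmin _ hP _ ha
    apply hne
    have hz : (g ≫ δ') ≫ S.map (e₀.inv ≫ T.first) = 0 := by
      have e : g ≫ δ' = e₁.inv ≫ T.last ≫ S.map e₀.hom := by rw [he, Iso.inv_hom_id_assoc]
      rw [e, Category.assoc, Category.assoc, ← S.map_comp, Iso.hom_inv_id_assoc,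
        A.last_comp_first hd hT, comp_zero]
    rw [← hs, S.map_comp, ← Category.assoc, ← Category.assoc, hz, zero_comp]

/-- A socle element for which every non-annihilating morphism is a split monomorphism is the
last morphism of an Auslander-Reiten angle in the subcategory. -/
lemma exists_isARAngleIn [IsIdempotentComplete M] (hd : 1 ≤ d) (hP : IsAdditiveSubcategory P)
    (hPext : ClosedUnderExtensions A P) {Z W₀ : M} (hZ : P Z) (hW₀ : P W₀)
    {δ' : Z ⟶ S.obj W₀} (hδ' : δ' ≠ 0) (hsocle : IsSocle P δ')
    (hsplit : ∀ W : M, P W → ∀ a : W₀ ⟶ W, δ' ≫ S.map a ≠ 0 → IsSplitMono a) :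
    ∃ T : SigmaSequence S d, IsARAngleIn A P T ∧ Nonempty (T.obj 0 ≅ W₀) ∧
      Nonempty (T.obj (Fin.last (d + 1)) ≅ Z) := by
  have := additive_of_isEquivalence S
  obtain ⟨T, hT, hTP, ⟨e₀, e₁, he⟩, hrad⟩ :=
    A.exists_radical_angle k hP hPext hW₀ hZ δ'
  have hlast : T.last ≠ 0 := fun h => hδ' <| by
    rw [h, zero_comp] at he
    rw [← cancel_epi e₁.hom, ← he, comp_zero]
  have hl : IsLeftAlmostSplit P T.first := by
    refine ⟨fun hs => hlast ?_, fun V hV g hg => A.exists_first_comp_eq hT g ?_⟩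
    · rw [← cancel_mono (S.map T.first), A.last_comp_first hd hT, zero_comp]
    · by_contra hne
      refine hg (isSplitMono_of_iso_comp e₀.symm (hsplit V hV (e₀.inv ≫ g) fun h => hne ?_))
      have e : T.last = e₁.hom ≫ δ' ≫ S.map e₀.inv := by
        rw [← reassoc_of% he, ← S.map_comp, Iso.hom_inv_id, S.map_id, Category.comp_id]
      rw [e, Category.assoc, Category.assoc, ← S.map_comp, h, comp_zero]
  have hr : IsRightAlmostSplit P T.final := by
    refine ⟨fun hs => hlast ?_, fun V hV g hg => A.exists_comp_final_eq hT g ?_⟩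
    · rw [← cancel_epi T.final, A.final_comp_last hd hT, comp_zero]
    · have h := hsocle V hV (g ≫ e₁.hom) fun h => hg (isSplitEpi_of_comp_iso e₁ h)
      rw [Category.assoc, ← he, ← Category.assoc] at h
      rwa [← cancel_mono (S.map e₀.hom), zero_comp]
  exact ⟨T, ⟨hT, hTP, hl, hr, hrad⟩, ⟨e₀⟩, ⟨e₁⟩⟩

end Angulation

include k in
/-- The first object of an Auslander-Reiten angle in a subcategory has a local endomorphism
ring. -/
lemma IsARAngleIn.isIso_or {A : Angulation S d} {T : SigmaSequence S d} (hT : IsARAngleIn A P T)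
    {W₀ : M} (ι : T.obj 0 ≅ W₀) (x : W₀ ⟶ W₀) : IsIso x ∨ IsIso (𝟙 W₀ - x) := by
  have hconj : ∀ y : W₀ ⟶ W₀, IsSplitMono (ι.hom ≫ y ≫ ι.inv) → IsIso y := fun y hy => by
    have := IsSplitMono.isIso_end k hy
    have e : y = ι.inv ≫ (ι.hom ≫ y ≫ ι.inv) ≫ ι.hom := by simp
    rw [e]
    infer_instance
  have hl : IsLeftAlmostSplit P T.first := hT.left
  obtain h | h := hl.isSplitMono_or (hT.obj_mem 0) (ι.hom ≫ x ≫ ι.inv)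
  · exact Or.inl (hconj x h)
  · refine Or.inr (hconj _ ?_)
    have e : ι.hom ≫ (𝟙 W₀ - x) ≫ ι.inv = 𝟙 (T.obj 0) - ι.hom ≫ x ≫ ι.inv := by
      simp [Preadditive.sub_comp, Preadditive.comp_sub]
    rwa [e]

end Main

end HigherAngulated

theorem theoremB {k : Type*} [Field k]
    {M : Type u} [Category.{v} M] [Preadditive M] [HasZeroObject M] [HasBinaryBiproducts M]
    [Linear k M] [∀ X Y : M, FiniteDimensional k (X ⟶ Y)]
    [EssentiallySmall.{v} M] [IsIdempotentComplete M]
    (S : M ⥤ M) [S.IsEquivalence] (d : ℕ) (hd : 1 ≤ d) (A : HigherAngulated.Angulation S d)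
    (P : ObjectProperty M) (hP : HigherAngulated.IsAdditiveSubcategory P)
    (hPext : HigherAngulated.ClosedUnderExtensions A P)
    (T : HigherAngulated.SigmaSequence S d) (hT : HigherAngulated.IsARAngle A T)
    (hW : P (T.obj (Fin.last (d + 1))))
    (U : M) (hU : P U) (γ : T.obj (Fin.last (d + 1)) ⟶ S.obj U) (hγ : γ ≠ 0)
    (W₀ : M) :
    (∃ φ : W₀ ⟶ T.obj 0, HigherAngulated.IsCover P φ) ↔
      ∃ T' : HigherAngulated.SigmaSequence S d, HigherAngulated.IsARAngleIn A P T' ∧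
        Nonempty (T'.obj 0 ≅ W₀) ∧
        Nonempty (T'.obj (Fin.last (d + 1)) ≅ T.obj (Fin.last (d + 1))) := by
  open HigherAngulated in
  have := additive_of_isEquivalence S
  have hr : IsRightAlmostSplit ⊤ T.final := hT.right
  have hδ : T.last ≠ 0 := A.last_ne_zero hT.mem_angles hr
  have hsocle : IsSocle P T.last := fun W _ g hg =>
    A.isSocle_last hd hT.mem_angles hr W trivial g hg
  have hfac : ∀ (W : M) (f : W ⟶ T.obj 0), f ≠ 0 →
      ∃ h : T.obj (Fin.last (d + 1)) ⟶ S.obj W, h ≫ S.map f = T.last := fun _ =>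
    A.exists_comp_map_eq_last hd hT.mem_angles hT.left
  constructor
  · rintro ⟨φ, hφ, hmin⟩
    obtain ⟨δ', hδ', H⟩ := A.exists_lift_of_isPrecover k hd hPext hW hsocle hφ hU hγ
    have hne : δ' ≠ 0 := fun h => hδ (by rw [← hδ', h, zero_comp])
    have hs' : IsSocle P δ' :=
      A.isSocle_of_minimal hd hPext hφ.1 (hr.isSplitEpi_or trivial) hne H
    refine A.exists_isARAngleIn k hd hP hPext hW hφ.1 hne hs' fun W hW' a ha => ?_
    obtain ⟨s, hs⟩ := H W hW' a ha
    -- Since a ≫ s fixes δ', its composite with φ also carries δ' to δ; it is a precover, and φ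
    -- itself factors through it.
    obtain ⟨t, ht⟩ := (A.isPrecover_of_isSocle k hd hPext hW hφ.1 hδ hfac hs' ((a ≫ s) ≫ φ) (by
      rw [S.map_comp, reassoc_of% hs, hδ'])).2 W₀ hφ.1 φ
    have hiso : IsIso (t ≫ a ≫ s) := hmin _ (by simpa using ht)
    have hid : (inv (t ≫ a ≫ s) ≫ t) ≫ a ≫ s = 𝟙 W₀ := by simp
    -- The inverse found is on the wrong side; finite dimension makes it two-sided.
    have hsplit : IsSplitMono (a ≫ s) := ⟨⟨⟨_, comp_eq_id_symm k hid⟩⟩⟩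
    exact isSplitMono_of_comp hsplit
  · rintro ⟨T', hT', ⟨ι⟩, ⟨ε⟩⟩
    have hr' : IsRightAlmostSplit P T'.final := hT'.right
    have hW₀ : P W₀ := hP.of_iso ι (hT'.obj_mem 0)
    have hne : T'.last ≠ 0 := A.last_ne_zero hT'.mem_angles hr'
    let δ' : T.obj (Fin.last (d + 1)) ⟶ S.obj W₀ := (ε.inv ≫ T'.last) ≫ S.map ι.hom
    have hs' : IsSocle P δ' :=
      ((A.isSocle_last hd hT'.mem_angles hr').iso_inv_comp ε).comp _
    have hne' : δ' ≠ 0 := fun h => hne <| by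
      rw [← cancel_mono (S.map ι.hom), ← cancel_epi ε.inv, zero_comp, comp_zero,
        ← Category.assoc]
      exact h
    obtain ⟨φ, hφ⟩ := A.exists_comp_map_eq_of_isSocle hd hPext hW hW₀ hsocle δ' hne'
    exact ⟨φ, A.isPrecover_of_isSocle k hd hPext hW hW₀ hδ hfac hs' φ hφ,
      isRightMinimal_of_local (hT'.isIso_or k ι) fun h => hδ (by
        rw [← hφ, h, S.map_zero, comp_zero])⟩
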